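/- **Setting.** Let $M$ be a compact Lie group (without boundary; e.g. $M=G^{\times n}$ with $G$ compact) with Haar measure, and let $\phi=(\phi^c)_c$, $\phi^c:M\times\mathbb R\to\mathbb C$, be finitely many smooth fields, possibly required to satisfy $\phi^c(k(g),\varphi)=\phi^c(g,\varphi)$ for all $k$ in a given set of maps $k:M\to M$ (gauge invariance, simplicity constraints). Let $L^{loc}$ be a smooth real function of $(g,\varphi)$, of the field values and of the first derivatives of the fields at $(g,\varphi)$. Let there be finitely many interactions: for each $i$ a compact Lie group $\Omega_i$ with Haar measure, smooth maps $f_{i,j}:\Omega_i\to M$ ($1\le j\le n_i$) and a smooth real function $L^{int}_i$ of $(x,\varphi)\in\Omega_i\times\mathbb R$ and of the values $\phi(f_{i,j}(x),\varphi)$, all taken at the same $\varphi$, and of no derivatives. The action is $$S=\int_{M\times\mathbb R}L^{loc}+\sum_i\int_{\Omega_i\times\mathbb R}L_i^{int},\qquad S|_\varphi=\int_M L^{loc}|_\varphi+\sum_i\int_{\Omega_i}L_i^{int}|_\varphi .$$ A field is *on shell* if it lies in the field space and for all $a<b$ the action over $a\le\varphi\le b$ is stationary under all variations in the field space that vanish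 for $\varphi\notin(a,b)$. Consider a smooth one-parameter group of point transformations $(g,\varphi,u)\mapsto(C_\epsilon(g,\varphi,u),\rho_\epsilon(\varphi),Q_\epsilon(g,\varphi,u))$ of $M\times\mathbb R\times\mathbb C^{\{c\}}$. It acts on fields by moving their graphs: wherever the transformed field $\tilde\phi$ is defined, $\tilde\phi(C_\epsilon(g,\varphi,\phi(g,\varphi)),\rho_\epsilon(\varphi))=Q_\epsilon(g,\varphi,\phi(g,\varphi))$. It is a *symmetry* if it preserves the field space, it lifts for each $i$ to a smooth one-parameter group of transformations of the bundle over $\Omega_i\times\mathbb R$ (the pullback of $n_i$ copies of the field bundle), and each functional in the action sum separately satisfies $S_{C(\Omega')}[\tilde\phi]=S_{\Omega'}[\phi]$ whenever $J\subseteq\mathbb R$ is open, $\tilde\phi$ is a transform of $\phi$ over $M\times J$ (both in the field space), and $\Omega'$ is a compact subset of $M\times J$, respectively of $\Omega_i\times J$. Its generator has components $X_M=\partial_\epsilon|_0C_\epsilon$, $X_{\mathbb R}^\varphi=\partial_\epsilon|_0\rho_\epsilon(\varphi)$, $X_V=\partial_\epsilon|_0Q_\epsilon$, taken at the value of the field,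 and its characteristic is $X_Q^c=X_V^c-X_M(\phi^c)-X_{\mathbb R}^\varphi\,\partial_\varphi\phi^c$. Let $\Pi^c=\partial_{\partial_\varphi\phi^c}L^{loc}$ and $\bar\Pi^c=\partial_{\partial_\varphi\bar\phi^c}L^{loc}$ (Wirtinger derivatives along the field), and define $$Q(\varphi)=S|_\varphi\,X^\varphi_{\mathbb R}+\int_M\sum_c\big(\Pi^cX_Q^c+\bar\Pi^c\bar X_Q^c\big).$$ **Claims.** 1. For every symmetry and every on-shell field, $Q$ is differentiable and $\partial_\varphi Q(\varphi)=0$ for all $\varphi$. 2. For the $U(1)$ transformations $\phi^c\mapsto e^{i\epsilon\theta^c}\phi^c$, $\theta^c\in\mathbb R$, one has $X_Q^c=i\theta^c\phi^c$ and, for every smooth field, $$Q(\varphi)=i\sum_c\theta^c\int_M\big(\phi^c\,\Pi^c-\bar\phi^c\,\bar\Pi^c\big).$$ 3. For transformations of $M$ alone ($X_V=0$, $X_{\mathbb R}=0$), in particular for $M\cong SU(2)^{n}$ and $g_i\mapsto e^{\epsilon A_i}g_ie^{\epsilon B_i}$ with $A_i,B_i\in\mathfrak{su}(2)$, one has $X_Q^c=-X_M(\phi^c)$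 and, for every smooth field, $$Q(\varphi)=-\int_M\sum_c\Pi^c\,X_M(\phi^c)-\int_M\sum_c\bar\Pi^c\,X_M(\bar\phi^c).$$ 4. If no Lagrangian depends explicitly on $\varphi$, the translations $\varphi\mapsto\varphi+\mu$ are a symmetry. In any case their charge is, for every smooth field, $$Q(\varphi)=-\int_M\sum_c\big(\Pi^c\,\partial_\varphi\phi^c+\bar\Pi^c\,\partial_\varphi\bar\phi^c\big)+S|_\varphi .$$ Up to sign this is the Legendre transform (a Hamiltonian) of $S|_\varphi$ viewed as a Lagrangian in the slice field $q=\phi(\cdot,\varphi)$ and the velocity $v=\partial_\varphi\phi(\cdot,\varphi)$: the derivative of $S|_\varphi$ with respect to the velocity, in the direction of any continuous $w=(w^c)_c$, $w^c:M\to\mathbb C$, exists and equals $\int_M\sum_c(\Pi^cw^c+\bar\Pi^c\bar w^c)$. -/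

import Mathlib

open scoped Manifold ContDiff
open MeasureTheory Set

universe u w

noncomputable section

/-- A compact (finite-dimensional, boundaryless) Lie group together with a Haar measure. The base
manifolds of group field theory are of this kind: finite products of copies of a group `G`. -/
structure HaarLieGroup where
  carrier : Type u
  vec : Type u
  model : Type u
  [normedVec : NormedAddCommGroup vec]
  [spaceVec : NormedSpace ℝ vec]
  [finVec : FiniteDimensional ℝ vec]
  [topModel : TopologicalSpace model]
  I : ModelWithCorners ℝ vec model
  [boundaryless : I.Boundaryless]
  [group : Group carrier]
  [top : TopologicalSpace carrier]
  [charted : ChartedSpace model carrier]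
  [lie : LieGroup I ∞ carrier]
  [compact : CompactSpace carrier]
  [t2 : T2Space carrier]
  [secondCountable : SecondCountableTopology carrier]
  [measurable : MeasurableSpace carrier]
  [borel : BorelSpace carrier]
  haar : Measure carrier
  [isHaar : haar.IsHaarMeasure]

namespace HaarLieGroup

instance : CoeSort HaarLieGroup.{u} (Type u) := ⟨HaarLieGroup.carrier⟩

attribute [instance] normedVec spaceVec finVec topModel boundaryless group top charted lie compact
  t2 secondCountable measurable borel isHaar

end HaarLieGroup

namespace GFT

/-- The fibre of the field bundle: one complex value for each colour. -/
abbrev Fib (C : Type w) : Type w := C → ℂ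

/-- A multiplet of (not necessarily smooth) fields `φ c (g, t)` on `M × ℝ`; `t` is the value of
the matter clock variable. -/
abbrev Field (C : Type w) (M : HaarLieGroup.{u}) : Type _ := C → M → ℝ → ℂ

/-- Fibre coordinates of the first jet bundle over `M × ℝ`, together with the clock variable:
`(t, u, p, v)` where `u` are the field values, `p` the derivatives of the fields along `M` (a linear
form on the Lie algebra for each colour, by left trivialisation), `v` the clock derivatives. -/
abbrev Jet (C : Type w) (M : HaarLieGroup.{u}) : Type _ :=
  ℝ × Fib C × (C → (M.vec →L[ℝ] ℂ)) × Fib C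

variable {C : Type w} [Fintype C] {M : HaarLieGroup.{u}}

/-- A non-local interaction term that is local in the clock variable. Its base manifold is
`Ω × ℝ`; the map `legs` from `Ω` to `M ^ arity` is the combinatorial pattern. The Lagrangian depends
on the point of `Ω × ℝ` and on the field values at the points `(legs j x, t)`, `j < arity`, all at the
same `t`, and on no derivatives of the fields. -/
structure Interaction (C : Type w) [Fintype C] (M : HaarLieGroup.{u}) where
  Ω : HaarLieGroup.{u}
  arity : ℕ
  legs : Fin arity → Ω → M
  legs_smooth : ∀ j, ContMDiff Ω.I M.I ∞ (legs j)
  lagrangian : Ω → ℝ × (Fin arity → Fib C) → ℝ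
  lagrangian_smooth : ContMDiff (Ω.I.prod 𝓘(ℝ, ℝ × (Fin arity → Fib C))) 𝓘(ℝ, ℝ) ∞
    (fun z : Ω × (ℝ × (Fin arity → Fib C)) => lagrangian z.1 z.2)

/-- A group field theory with fields on `M × ℝ`: a local first-order Lagrangian, finitely many
interaction terms, and a set of maps of `M` under which the fields are required to be invariant (gauge
invariance, simplicity constraints; empty if no constraint is imposed). -/
structure Model (C : Type w) [Fintype C] (M : HaarLieGroup.{u}) where
  locLagrangian : M → Jet C M → ℝ
  locLagrangian_smooth : ContMDiff (M.I.prod 𝓘(ℝ, Jet C M)) 𝓘(ℝ, ℝ) ∞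
    (fun z : M × Jet C M => locLagrangian z.1 z.2)
  numInter : ℕ
  inter : Fin numInter → Interaction C M
  constraints : Set (M → M)

/-- The value of the field multiplet at a point of `M × ℝ`. -/
def val (φ : Field C M) (g : M) (t : ℝ) : Fib C := fun c => φ c g t

/-- The derivative `∂_t φ` with respect to the clock variable. -/
def clockDeriv (φ : Field C M) (g : M) (t : ℝ) : Fib C := fun c => deriv (fun s => φ c g s) t

/-- Left-trivialised differential of a function on the group: the derivative of `h ↦ q (g h)` at the
identity, a linear form on the Lie algebra. -/
def leftGrad (q : M → ℂ) (g : M) : M.vec →L[ℝ] ℂ :=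
  mfderiv M.I 𝓘(ℝ, ℂ) (fun h : M => q (g * h)) 1

/-- The jet with values and group derivatives taken from `q`, and clock velocity `v`. -/
def sliceJet (t : ℝ) (q v : C → M → ℂ) (g : M) : Jet C M :=
  (t, fun c => q c g, fun c => leftGrad (q c) g, fun c => v c g)

/-- The restriction of the fields to fixed `t`, and of their clock derivatives. -/
def slice (φ : Field C M) (t : ℝ) : C → M → ℂ := fun c g => φ c g t

def sliceVel (φ : Field C M) (t : ℝ) : C → M → ℂ := fun c g => clockDeriv φ g t c

/-- The first jet of the field multiplet. -/
def jet (φ : Field C M) (g : M) (t : ℝ) : Jet C M := sliceJet t (slice φ t) (sliceVel φ t) g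

def Smooth (φ : Field C M) : Prop :=
  ∀ c, ContMDiff (M.I.prod 𝓘(ℝ, ℝ)) 𝓘(ℝ, ℂ) ∞ (fun p : M × ℝ => φ c p.1 p.2)

namespace Interaction

variable (T : Interaction C M)

/-- The values of the fields at the legs of the interaction. -/
def legVals (φ : Field C M) (x : T.Ω) (t : ℝ) : Fin T.arity → Fib C :=
  fun j => val φ (T.legs j x) t

/-- The interaction functional over a subdomain of `Ω × ℝ`. -/
def action (φ : Field C M) (A : Set (T.Ω × ℝ)) : ℝ :=
  ∫ p in A, T.lagrangian p.1 (p.2, T.legVals φ p.1 p.2) ∂(T.Ω.haar.prod volume)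

end Interaction

namespace Model

variable (S : Model C M)

/-- The field space: smooth fields that satisfy the constraints. -/
def Admissible (φ : Field C M) : Prop :=
  Smooth φ ∧ ∀ k ∈ S.constraints, ∀ c g t, φ c (k g) t = φ c g t

/-- The local functional over a subdomain of `M × ℝ`. -/
def locAction (φ : Field C M) (A : Set (M × ℝ)) : ℝ :=
  ∫ p in A, S.locLagrangian p.1 (jet φ p.1 p.2) ∂(M.haar.prod volume)

/-- The full action over the slab `a ≤ t ≤ b`. -/
def action (φ : Field C M) (a b : ℝ) : ℝ :=
  S.locAction φ (univ ×ˢ Icc a b) + ∑ i, (S.inter i).action φ (univ ×ˢ Icc a b)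

/-- Solutions of the equations of motion: the action is stationary under all admissible variations
that are supported between two values of the clock variable. -/
def OnShell (φ : Field C M) : Prop :=
  S.Admissible φ ∧ ∀ a b : ℝ, a < b → ∀ η : Field C M, S.Admissible η →
    (∀ c g, ∀ t ∉ Ioo a b, η c g t = 0) →
    HasDerivAt (fun ε : ℝ => S.action (fun c g t => φ c g t + (ε : ℂ) * η c g t) a b) 0 0

/-- The Lagrangian on a slice of fixed `t`, as a functional of the field configuration `q` on `M`
and of the velocity `v`: integral of the local Lagrangian over `M` plus integrals of the interaction
Lagrangians over their domains. -/
def sliceLagrangian (t : ℝ) (q v : C → M → ℂ) : ℝ :=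
  (∫ g, S.locLagrangian g (sliceJet t q v g) ∂M.haar) +
    ∑ i, ∫ x, (S.inter i).lagrangian x (t, fun j c => q c ((S.inter i).legs j x)) ∂(S.inter i).Ω.haar

/-- `S|_t`, the action at the fixed value `t` of the clock variable. -/
def sliceAction (φ : Field C M) (t : ℝ) : ℝ := S.sliceLagrangian t (slice φ t) (sliceVel φ t)

open Classical in
/-- Real directional derivative of the local Lagrangian in the clock velocity of colour `c`, in the
direction `z : ℂ`. -/
def velDeriv (c : C) (g : M) (J : Jet C M) (z : ℂ) : ℝ :=
  fderiv ℝ (fun v : Fib C => S.locLagrangian g (J.1, J.2.1, J.2.2.1, v)) J.2.2.2 (Pi.single c z)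

/-- The Wirtinger derivative `∂L/∂(∂_t φ^c)` of the local Lagrangian. -/
def momentumJet (c : C) (g : M) (J : Jet C M) : ℂ :=
  ((S.velDeriv c g J 1 : ℂ) - Complex.I * (S.velDeriv c g J Complex.I : ℂ)) / 2

/-- The Wirtinger derivative `∂L/∂(∂_t φ̄^c)` of the local Lagrangian. -/
def momentumBarJet (c : C) (g : M) (J : Jet C M) : ℂ :=
  ((S.velDeriv c g J 1 : ℂ) + Complex.I * (S.velDeriv c g J Complex.I : ℂ)) / 2

/-- `Π^c`, along a field. -/
def mom (φ : Field C M) (c : C) (g : M) (t : ℝ) : ℂ := S.momentumJet c g (jet φ g t)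

/-- `Π̄^c`, along a field. -/
def momBar (φ : Field C M) (c : C) (g : M) (t : ℝ) : ℂ := S.momentumBarJet c g (jet φ g t)

end Model

/-- A one-parameter group of Lie point transformations of the bundle `(M × ℝ) × ℂ^C`,
`(g, t, u) ↦ (base s g t u, clock s t, fiber s g t u)`, that respects the slicing by `t`. -/
structure PointFlow (C : Type w) [Fintype C] (M : HaarLieGroup.{u}) where
  base : ℝ → M → ℝ → Fib C → M
  clock : ℝ → ℝ → ℝ
  fiber : ℝ → M → ℝ → Fib C → Fib C
  base_smooth : ContMDiff (𝓘(ℝ, ℝ).prod (M.I.prod 𝓘(ℝ, ℝ × Fib C))) M.I ∞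
    (fun z : ℝ × (M × (ℝ × Fib C)) => base z.1 z.2.1 z.2.2.1 z.2.2.2)
  clock_smooth : ContDiff ℝ ∞ (fun z : ℝ × ℝ => clock z.1 z.2)
  fiber_smooth : ContMDiff (𝓘(ℝ, ℝ).prod (M.I.prod 𝓘(ℝ, ℝ × Fib C))) 𝓘(ℝ, Fib C) ∞
    (fun z : ℝ × (M × (ℝ × Fib C)) => fiber z.1 z.2.1 z.2.2.1 z.2.2.2)
  base_zero : ∀ g t u, base 0 g t u = g
  clock_zero : ∀ t, clock 0 t = t
  fiber_zero : ∀ g t u, fiber 0 g t u = u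
  base_add : ∀ r s g t u, base (r + s) g t u = base r (base s g t u) (clock s t) (fiber s g t u)
  clock_add : ∀ r s t, clock (r + s) t = clock r (clock s t)
  fiber_add : ∀ r s g t u, fiber (r + s) g t u = fiber r (base s g t u) (clock s t) (fiber s g t u)

namespace PointFlow

variable (Φ : PointFlow C M)

/-- `ψ` is the transform of `φ` by the transformation with parameter `s`, over the clock values in
`J`: the transformation maps the graph of `φ` over `M × J` into the graph of `ψ`. -/
def Transforms (s : ℝ) (J : Set ℝ) (φ ψ : Field C M) : Prop :=
  ∀ g, ∀ t ∈ J, ∀ c,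
    ψ c (Φ.base s g t (val φ g t)) (Φ.clock s t) = Φ.fiber s g t (val φ g t) c

/-- The transformation of the base manifold `M × ℝ` determined by a field `φ`. -/
def baseMap (s : ℝ) (φ : Field C M) (p : M × ℝ) : M × ℝ :=
  (Φ.base s p.1 p.2 (val φ p.1 p.2), Φ.clock s p.2)

/-- `K` is the base part of the one-parameter group of transformations that `Φ` induces on the bundle
of the interaction term `T`, the pullback of `arity` copies of the field bundle along `legs`. -/
structure IsLift (T : Interaction C M)
    (K : ℝ → T.Ω → ℝ → (Fin T.arity → Fib C) → T.Ω) : Prop where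
  smooth : ContMDiff (𝓘(ℝ, ℝ).prod (T.Ω.I.prod 𝓘(ℝ, ℝ × (Fin T.arity → Fib C)))) T.Ω.I ∞
    (fun z : ℝ × (T.Ω × (ℝ × (Fin T.arity → Fib C))) => K z.1 z.2.1 z.2.2.1 z.2.2.2)
  zero : ∀ x t w, K 0 x t w = x
  add : ∀ r s x t w, K (r + s) x t w =
    K r (K s x t w) (Φ.clock s t) (fun j => Φ.fiber s (T.legs j x) t (w j))
  legs : ∀ s x t w j, T.legs j (K s x t w) = Φ.base s (T.legs j x) t (w j)

/-- The component `X_ℝ` of the generator along the clock direction. -/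
def clockGen (t : ℝ) : ℝ := deriv (fun s => Φ.clock s t) 0

/-- The component `X_V` of the generator along the fibre, at the value of the field. -/
def fiberGen (φ : Field C M) (c : C) (g : M) (t : ℝ) : ℂ :=
  deriv (fun s => Φ.fiber s g t (val φ g t) c) 0

/-- The Lie derivative of a function `q` on `M × ℝ` along the base component `X_M + X_ℝ ∂_t` of the
generator, taken at the value of the field `φ`. -/
def lieDeriv (φ : Field C M) (q : M → ℝ → ℂ) (g : M) (t : ℝ) : ℂ :=
  deriv (fun s => q (Φ.base s g t (val φ g t)) (Φ.clock s t)) 0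

/-- The characteristic `X_Q^c = X_V^c - X(φ^c)`, with `X = X_M + X_ℝ ∂_t`. -/
def char (φ : Field C M) (c : C) (g : M) (t : ℝ) : ℂ :=
  Φ.fiberGen φ c g t - Φ.lieDeriv φ (φ c) g t

end PointFlow

namespace Model

variable (S : Model C M)

/-- Symmetries of the action: the transformations preserve the field space, and they are Lie point
symmetries of each functional in the action sum, that is, each functional over each subdomain is equal
to the same functional of the transformed field over the transformed subdomain. -/
structure IsSymmetry (Φ : PointFlow C M) : Prop where
  preserves : ∀ s, ∀ J : Set ℝ, IsOpen J → ∀ φ ψ, S.Admissible φ → Smooth ψ →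
    Φ.Transforms s J φ ψ →
    ∀ k ∈ S.constraints, ∀ c g, ∀ t ∈ J, ψ c (k g) (Φ.clock s t) = ψ c g (Φ.clock s t)
  loc : ∀ s, ∀ J : Set ℝ, IsOpen J → ∀ φ ψ, S.Admissible φ → S.Admissible ψ →
    Φ.Transforms s J φ ψ → ∀ A : Set (M × ℝ), IsCompact A → A ⊆ univ ×ˢ J →
    S.locAction ψ (Φ.baseMap s φ '' A) = S.locAction φ A
  inter : ∀ i, ∃ K, Φ.IsLift (S.inter i) K ∧
    ∀ s, ∀ J : Set ℝ, IsOpen J → ∀ φ ψ, S.Admissible φ → S.Admissible ψ →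
    Φ.Transforms s J φ ψ → ∀ A : Set ((S.inter i).Ω × ℝ), IsCompact A → A ⊆ univ ×ˢ J →
    (S.inter i).action ψ
      ((fun p => (K s p.1 p.2 ((S.inter i).legVals φ p.1 p.2), Φ.clock s p.2)) '' A) =
    (S.inter i).action φ A

/-- The charge
`Q(t) = S|_t X_ℝ(t) + ∫_M ∑_c (∂L/∂(∂_t φ^c) X_Q^c + ∂L/∂(∂_t φ̄^c) X̄_Q^c)`. -/
def charge (Φ : PointFlow C M) (φ : Field C M) (t : ℝ) : ℂ :=
  ((S.sliceAction φ t * Φ.clockGen t : ℝ) : ℂ) +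
    ∫ g, ∑ c, (S.mom φ c g t * Φ.char φ c g t +
      S.momBar φ c g t * (starRingEnd ℂ) (Φ.char φ c g t)) ∂M.haar

/-- The model does not depend explicitly on the clock variable. -/
def ClockIndependent : Prop :=
  (∀ g t t' u p v, S.locLagrangian g (t, u, p, v) = S.locLagrangian g (t', u, p, v)) ∧
  ∀ i x t t' w, (S.inter i).lagrangian x (t, w) = (S.inter i).lagrangian x (t', w)

end Model

lemma phase_contDiff (θ : ℝ) :
    ContDiff ℝ ∞ (fun z : ℝ × ℂ => Complex.exp (Complex.I * z.1 * θ) * z.2) := by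
  have h0 : ContDiff ℝ ∞ (fun x : ℝ => (x : ℂ)) := Complex.ofRealCLM.contDiff
  have h1 : ContDiff ℝ ∞ (fun z : ℝ × ℂ => (z.1 : ℂ)) := h0.comp contDiff_fst
  have h2 : ContDiff ℝ ∞ (fun z : ℝ × ℂ => Complex.I * (z.1 : ℂ) * θ) :=
    (contDiff_const.mul h1).mul contDiff_const
  exact h2.cexp.mul contDiff_snd

lemma phase_comp {X : Type*} [TopologicalSpace X] {H : Type*} [TopologicalSpace H] {E : Type*}
    [NormedAddCommGroup E] [NormedSpace ℝ E] {I : ModelWithCorners ℝ E H} [ChartedSpace H X]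
    {a : X → ℝ} {b : X → ℂ} (ha : ContMDiff I 𝓘(ℝ, ℝ) ∞ a) (hb : ContMDiff I 𝓘(ℝ, ℂ) ∞ b) (θ : ℝ) :
    ContMDiff I 𝓘(ℝ, ℂ) ∞ (fun x => Complex.exp (Complex.I * a x * θ) * b x) := by
  have h := (phase_contDiff θ).contMDiff.comp (ha.prodMk_space hb)
  exact h

lemma phase_smooth (M : HaarLieGroup.{u}) (θ : C → ℝ) :
    ContMDiff (𝓘(ℝ, ℝ).prod (M.I.prod 𝓘(ℝ, ℝ × Fib C))) 𝓘(ℝ, Fib C) ∞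
      (fun z : ℝ × (M × (ℝ × Fib C)) =>
        (fun c => Complex.exp (Complex.I * z.1 * θ c) * z.2.2.2 c : Fib C)) := by
  refine contMDiff_pi_space.2 fun c => ?_
  have h1 : ContMDiff (𝓘(ℝ, ℝ).prod (M.I.prod 𝓘(ℝ, ℝ × Fib C))) 𝓘(ℝ, ℝ) ∞
      (fun z : ℝ × (M × (ℝ × Fib C)) => z.1) := contMDiff_fst
  have h2 : ContMDiff (𝓘(ℝ, ℝ).prod (M.I.prod 𝓘(ℝ, ℝ × Fib C))) 𝓘(ℝ, ℂ) ∞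
      (fun z : ℝ × (M × (ℝ × Fib C)) => z.2.2.2 c) := by
    have h3 : ContDiff ℝ ∞ (fun y : ℝ × Fib C => y.2 c) := by fun_prop
    have h4 : ContMDiff (𝓘(ℝ, ℝ).prod (M.I.prod 𝓘(ℝ, ℝ × Fib C))) (M.I.prod 𝓘(ℝ, ℝ × Fib C)) ∞
        (fun z : ℝ × (M × (ℝ × Fib C)) => z.2) := contMDiff_snd
    exact h3.contMDiff.comp h4.snd
  exact phase_comp h1 h2 _

/-- The group of phase rotations `φ^c ↦ exp(i s θ_c) φ^c`. -/
def phaseFlow (M : HaarLieGroup.{u}) (θ : C → ℝ) : PointFlow C M where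
  base _ g _ _ := g
  clock _ t := t
  fiber s _ _ u := fun c => Complex.exp (Complex.I * s * θ c) * u c
  base_smooth := by
    have h : ContMDiff (𝓘(ℝ, ℝ).prod (M.I.prod 𝓘(ℝ, ℝ × Fib C))) (M.I.prod 𝓘(ℝ, ℝ × Fib C)) ∞
        (fun z : ℝ × (M × (ℝ × Fib C)) => z.2) := contMDiff_snd
    exact h.fst
  clock_smooth := contDiff_snd
  fiber_smooth := phase_smooth M θ
  base_zero _ _ _ := rfl
  clock_zero _ := rfl
  fiber_zero _ _ u := by funext c; simp
  base_add _ _ _ _ _ := rfl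
  clock_add _ _ _ := rfl
  fiber_add r s g t u := by
    funext c
    rw [← mul_assoc, ← Complex.exp_add]
    push_cast
    ring_nf

/-- The group of translations `t ↦ t + s` of the clock variable. -/
def translationFlow (C : Type w) [Fintype C] (M : HaarLieGroup.{u}) : PointFlow C M where
  base _ g _ _ := g
  clock s t := t + s
  fiber _ _ _ u := u
  base_smooth := by
    have h : ContMDiff (𝓘(ℝ, ℝ).prod (M.I.prod 𝓘(ℝ, ℝ × Fib C))) (M.I.prod 𝓘(ℝ, ℝ × Fib C)) ∞
        (fun z : ℝ × (M × (ℝ × Fib C)) => z.2) := contMDiff_snd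
    exact h.fst
  clock_smooth := contDiff_snd.add contDiff_fst
  fiber_smooth := by
    have h : ContMDiff (𝓘(ℝ, ℝ).prod (M.I.prod 𝓘(ℝ, ℝ × Fib C))) (M.I.prod 𝓘(ℝ, ℝ × Fib C)) ∞
        (fun z : ℝ × (M × (ℝ × Fib C)) => z.2) := contMDiff_snd
    have h1 : ContDiff ℝ ∞ (fun y : ℝ × Fib C => y.2) := contDiff_snd
    exact h1.contMDiff.comp h.snd
  base_zero _ _ _ := rfl
  clock_zero t := by simp
  fiber_zero _ _ _ := rfl
  base_add _ _ _ _ _ := rfl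
  clock_add r s t := by ring
  fiber_add _ _ _ _ _ := rfl

/-- The transformations act on `M` alone: the clock variable and the field values do not change. -/
def PointFlow.IsPureBase (Φ : PointFlow C M) : Prop :=
  (∀ s t, Φ.clock s t = t) ∧ ∀ s g t u, Φ.fiber s g t u = u

/-- `M` is identified with `SU(2)^n` by `e`, and the transformations of `M` are the multiplications
by one-parameter subgroups, `g_i ↦ exp(s A_i) g_i exp(s B_i)` with `A_i, B_i ∈ 𝔰𝔲(2)`. The case `B = 0` is
left multiplication, the case `A = 0` is the flow of left invariant vector fields. -/
def PointFlow.IsSU2Translation (Φ : PointFlow C M) {n : ℕ}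
    (e : M ≃* (Fin n → Matrix.specialUnitaryGroup (Fin 2) ℂ))
    (A B : Fin n → Matrix (Fin 2) (Fin 2) ℂ) : Prop :=
  Continuous e ∧ Φ.IsPureBase ∧
    (∀ i, (A i).conjTranspose = -A i ∧ (A i).trace = 0) ∧
    (∀ i, (B i).conjTranspose = -B i ∧ (B i).trace = 0) ∧
    ∀ s g t u i, (e (Φ.base s g t u) i : Matrix (Fin 2) (Fin 2) ℂ) =
      NormedSpace.exp (s • A i) * (e g i : Matrix (Fin 2) (Fin 2) ℂ) * NormedSpace.exp (s • B i)

end GFT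

end

/-! Noether's argument, carried out on slices of constant clock value. For a variation `δ` of a
field `φ`, let `E(t)` be the first variation of the slice action (`sliceVar`) and `P(t)` the
integral over `M` of the momenta paired with `δ` (`slicePair`). Multiplication of `δ` by a function
`χ` of the clock variable alone keeps the constraints and commutes with everything except the clock
derivative; the interactions are local in `t` and free of derivatives, so they only acquire the
factor `χ(t)`. Stationarity under `χδ` therefore reads `∫ (χE + χ'P) = 0` for all test functions
`χ`, that is `E = P'` (`OnShell.hasDerivAt_slicePair`). Neither Euler–Lagrange equations on `M` or
on the interaction domains nor integration by parts on a group are needed.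

For a symmetry, `δ` is the derivative at `s = 0` of the transforms `Ψ s` of `φ`. The transform of a
graph need not be a graph, so `Ψ s` is built only for small `s` and a bounded range of `t`, as a
fixed point of a contraction depending smoothly on all parameters (`PointFlow.exists_transforms`),
and is then cut off to an admissible field (`IsSymmetry.exists_transforms`). On that range `δ` is
the characteristic (`variation_eq_char`). The action of `Ψ s` over the transformed slab does not
depend on `s` (`IsSymmetry.action_eq`). Its derivative at `0` is `∫_a^b E` plus the moving-end terms
`S|_b X_ℝ(b) - S|_a X_ℝ(a)`; with `E = P'` the vanishing of this sum says that the charge agrees at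
`a` and `b`.

The remaining claims are computations of the characteristic, together with the identity
`sum_momentumJet` between Wirtinger and real derivatives; the Legendre statement is differentiation
under the integral sign. -/

noncomputable section

/-! ### Derivatives depending on parameters. -/

section Calculus

open Topology

variable {E F : Type*} [NormedAddCommGroup E] [NormedSpace ℝ E] [NormedAddCommGroup F]
  [NormedSpace ℝ F]

/-- Partial derivatives of a jointly smooth function commute. -/
lemma hasDerivAt_fderiv_comm {f : ℝ → E → F} {s : ℝ} {y : E}
    (hf : ContDiffAt ℝ ∞ (Function.uncurry f) (s, y)) :
    HasDerivAt (fun r => fderiv ℝ (f r) y) (fderiv ℝ (fun z => deriv (fun r => f r z) s) y) s := by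
  set G := Function.uncurry f with hG
  have hd : ∀ᶠ p in 𝓝 (s, y), DifferentiableAt ℝ G p :=
    ((hf.of_le (show (1 : ℕ∞ω) ≤ ∞ by norm_cast)).eventually (by simp)).mono fun p hp =>
      hp.differentiableAt one_ne_zero
  have hd1 : ∀ᶠ r in 𝓝 s, DifferentiableAt ℝ G (r, y) :=
    (Continuous.tendsto (by fun_prop : Continuous fun r : ℝ => (r, y)) s).eventually hd
  have hd2 : ∀ᶠ z in 𝓝 y, DifferentiableAt ℝ G (s, z) :=
    (Continuous.tendsto (by fun_prop : Continuous fun z : E => (s, z)) y).eventually hd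
  have hDG : DifferentiableAt ℝ (fderiv ℝ G) (s, y) :=
    (hf.fderiv_right (m := 1) (by norm_cast)).differentiableAt one_ne_zero
  have e1 : (fun r => fderiv ℝ (f r) y) =ᶠ[𝓝 s]
      fun r => (fderiv ℝ G (r, y)).comp (ContinuousLinearMap.inr ℝ ℝ E) := by
    filter_upwards [hd1] with r hr
    exact (hr.hasFDerivAt.comp y (hasFDerivAt_prodMk_right r y)).fderiv
  have e2 : (fun z => deriv (fun r => f r z) s) =ᶠ[𝓝 y] fun z => fderiv ℝ G (s, z) (1, 0) := by
    filter_upwards [hd2] with z hz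
    have := (hz.hasFDerivAt.comp s (hasFDerivAt_prodMk_left s z)).hasDerivAt
    simpa [Function.comp_def, hG] using this.deriv
  rw [e2.fderiv_eq]
  refine HasDerivAt.congr_of_eventuallyEq ?_ e1
  have k1 := HasFDerivAt.comp (g := fderiv ℝ G) s hDG.hasFDerivAt
    (hasFDerivAt_prodMk_left (𝕜 := ℝ) s y)
  have k2 := HasFDerivAt.comp (g := fderiv ℝ G) y hDG.hasFDerivAt
    (hasFDerivAt_prodMk_right (𝕜 := ℝ) s y)
  have k2' := (k2.clm_apply (hasFDerivAt_const ((1 : ℝ), (0 : E)) y)).fderiv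
  have k1' := k1.hasDerivAt.clm_comp
    (hasDerivAt_const s (ContinuousLinearMap.inr ℝ ℝ E))
  refine k1'.congr_deriv ?_
  -- Both sides are second derivatives of `G` at `(s, y)` along `(1, 0)` and `(0, v)`, taken in
  -- opposite orders.
  have hsymm : IsSymmSndFDerivAt ℝ G (s, y) := hf.isSymmSndFDerivAt (by simp; norm_cast)
  ext v
  simp only [Function.comp_def] at k2'
  rw [k2']
  simpa using hsymm.eq (1, 0) (0, v)

variable {H' E' N : Type*} [NormedAddCommGroup E'] [NormedSpace ℝ E'] [TopologicalSpace H']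
  {J : ModelWithCorners ℝ E' H'} [TopologicalSpace N] [ChartedSpace H' N] [IsManifold J ∞ N]

/-- Between vector spaces the tangent coordinates in the general statement for `mfderiv` are
trivial, which leaves the ordinary Fréchet derivative. -/
lemma ContMDiffAt.fderiv_param {f : N → E → F} {g : N → E} {n : N}
    (hf : ContMDiffAt (J.prod 𝓘(ℝ, E)) 𝓘(ℝ, F) ∞ (Function.uncurry f) (n, g n))
    (hg : ContMDiffAt J 𝓘(ℝ, E) ∞ g n) :
    ContMDiffAt J 𝓘(ℝ, E →L[ℝ] F) ∞ (fun x => fderiv ℝ (f x) (g x)) n := by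
  have := ContMDiffAt.mfderiv f g hf hg (m := ∞) (by simp)
  have e := inTangentCoordinates_model_space (I := 𝓘(ℝ, E)) (I' := 𝓘(ℝ, F)) g (fun x => f x (g x))
    (fun x => mfderiv 𝓘(ℝ, E) 𝓘(ℝ, F) (f x) (g x)) n
  simp only [mfderiv_eq_fderiv] at e this
  exact e ▸ this

lemma ContMDiffAt.deriv_param {f : N → ℝ → F} {g : N → ℝ} {n : N}
    (hf : ContMDiffAt (J.prod 𝓘(ℝ, ℝ)) 𝓘(ℝ, F) ∞ (Function.uncurry f) (n, g n))
    (hg : ContMDiffAt J 𝓘(ℝ, ℝ) ∞ g n) :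
    ContMDiffAt J 𝓘(ℝ, F) ∞ (fun x => deriv (f x) (g x)) n := by
  have h := hf.fderiv_param hg
  have h1 : ContDiff ℝ ∞ (fun A : ℝ →L[ℝ] F => A 1) := by fun_prop
  exact h1.contMDiff.contMDiffAt.comp n h

end Calculus

/-! ### Differentiation under the integral sign and moving end points. -/

section Integration

open Topology

variable {X E : Type*} [TopologicalSpace X] [CompactSpace X] [MeasurableSpace X]
  [OpensMeasurableSpace X] [NormedAddCommGroup E] {μ : Measure X} [IsFiniteMeasure μ]

lemma Continuous.integrable_of_compactSpace [T2Space X] {f : X → E} (hf : Continuous f) : Integrable f μ := by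
  have := integrableOn_univ.1 (hf.continuousOn.integrableOn_compact (μ := μ) isCompact_univ)
  exact this

variable [NormedSpace ℝ E]

/-- Differentiation under the integral sign over a compact space. -/
lemma hasDerivAt_integral_of_compactSpace [T2Space X] {f f' : ℝ → X → E}
    (hf : ∀ s, Continuous (f s)) (hf' : Continuous (Function.uncurry f'))
    (h : ∀ s x, HasDerivAt (fun r => f r x) (f' s x) s) (s : ℝ) :
    HasDerivAt (fun r => ∫ x, f r x ∂μ) (∫ x, f' s x ∂μ) s := by
  obtain ⟨B, hB⟩ := ((isCompact_Icc (a := s - 1) (b := s + 1)).prod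
    (isCompact_univ (X := X))).bddAbove_image hf'.norm.continuousOn
  refine (hasDerivAt_integral_of_dominated_loc_of_deriv_le (bound := fun _ => B)
    (Icc_mem_nhds (a := s - 1) (b := s + 1) (by linarith) (by linarith))
    (.of_forall fun r => (hf r).integrable_of_compactSpace.aestronglyMeasurable)
    (hf s).integrable_of_compactSpace
    (Continuous.integrable_of_compactSpace (by fun_prop)).aestronglyMeasurable
    (.of_forall fun x r hr => ?_) (integrable_const _) (.of_forall fun x r _ => h r x)).2
  exact hB (mem_image_of_mem (fun p : ℝ × X => ‖Function.uncurry f' p‖)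
    (mk_mem_prod hr (mem_univ x)))

lemma continuous_integral_of_compactSpace [SecondCountableTopology X] {Y : Type*} [TopologicalSpace Y]
    [FirstCountableTopology Y] [LocallyCompactSpace Y] {f : Y → X → E}
    (hf : Continuous (Function.uncurry f)) : Continuous fun y => ∫ x, f y x ∂μ := by
  simpa using continuous_parametric_integral_of_continuous (μ := μ) hf isCompact_univ

end Integration

section IntervalIntegration

open Topology

lemma hasDerivAt_intervalIntegral_of_continuous {f f' : ℝ → ℝ → ℝ}
    (hf : Continuous (Function.uncurry f)) (hf' : Continuous (Function.uncurry f'))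
    (h : ∀ s t, HasDerivAt (fun r => f r t) (f' s t) s) (a b s : ℝ) :
    HasDerivAt (fun r => ∫ t in a..b, f r t) (∫ t in a..b, f' s t) s := by
  obtain ⟨B, hB⟩ := ((isCompact_Icc (a := s - 1) (b := s + 1)).prod
    (isCompact_uIcc (a := a) (b := b))).bddAbove_image hf'.norm.continuousOn
  have hc : ∀ r, Continuous (f r) := fun r => by fun_prop
  have hc' : Continuous (f' s) := by fun_prop
  refine (intervalIntegral.hasDerivAt_integral_of_dominated_loc_of_deriv_le (bound := fun _ => B)
    (Icc_mem_nhds (a := s - 1) (b := s + 1) (by linarith) (by linarith))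
    (.of_forall fun r => (hc r).aestronglyMeasurable)
    ((hc s).intervalIntegrable _ _) hc'.aestronglyMeasurable
    (.of_forall fun x hx r hr => ?_) (by simp) (.of_forall fun x _ r _ => h r x)).2
  exact hB (mem_image_of_mem (fun p : ℝ × ℝ => ‖Function.uncurry f' p‖)
    (mk_mem_prod hr (uIoc_subset_uIcc hx)))

/-- Since `k s = 0`, the difference quotient of the product is that of `k` times `m r`, so
continuity of `m` suffices. -/
lemma HasDerivAt.mul_of_eq_zero {k m : ℝ → ℝ} {k' s : ℝ} (hk : HasDerivAt k k' s) (h0 : k s = 0)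
    (hm : ContinuousAt m s) : HasDerivAt (fun r => k r * m r) (k' * m s) s := by
  rw [hasDerivAt_iff_tendsto_slope] at hk ⊢
  have := hk.mul (hm.tendsto.mono_left (nhdsWithin_le_nhds (s := {s}ᶜ)))
  refine this.congr fun r => ?_
  simp [slope_def_field, h0]
  ring

/-- Derivative of an integral with one moving end point, at a parameter where the domain is
degenerate. -/
lemma hasDerivAt_integral_moving_end {f : ℝ → ℝ → ℝ} (hf : Continuous (Function.uncurry f))
    {ρ : ℝ → ℝ} {ρ' b : ℝ} (hρ : HasDerivAt ρ ρ' 0) (h0 : ρ 0 = b) :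
    HasDerivAt (fun s => ∫ t in b..ρ s, f s t) (ρ' * f 0 b) 0 := by
  -- The substitution `t = b + (ρ s - b) x` fixes the domain and produces a factor vanishing at `s =
  -- 0`; no derivative of `f` is then needed.
  have h1 : ∀ s, ∫ t in b..ρ s, f s t = (ρ s - b) * ∫ x in (0 : ℝ)..1, f s (b + (ρ s - b) * x) := by
    intro s
    rw [intervalIntegral.mul_integral_comp_add_mul]
    simp
  simp only [h1]
  have hm : ContinuousAt (fun s => ∫ x in (0 : ℝ)..1, f s (b + (ρ s - b) * x)) 0 := by
    have hq : Continuous fun q : ℝ × ℝ => ∫ x in (0 : ℝ)..1, f q.1 (b + (q.2 - b) * x) :=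
      intervalIntegral.continuous_parametric_intervalIntegral_of_continuous'
        (f := fun (q : ℝ × ℝ) x => f q.1 (b + (q.2 - b) * x)) (by
          have : Continuous fun z : (ℝ × ℝ) × ℝ => (z.1.1, b + (z.1.2 - b) * z.2) := by fun_prop
          exact hf.comp this) 0 1
    exact hq.continuousAt.comp (f := fun s => (s, ρ s)) (continuousAt_id.prodMk hρ.continuousAt)
  have := (hρ.sub_const b).mul_of_eq_zero (by simp [h0]) hm
  simpa [h0] using this

end IntervalIntegration

namespace HaarLieGroup

open Topology

/-- Integrals over a compact Lie group of a smooth function of two real parameters. -/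
lemma integral_param (X : HaarLieGroup.{u}) {f : ℝ → X → ℝ → ℝ}
    (hf : ContMDiff (𝓘(ℝ, ℝ).prod (X.I.prod 𝓘(ℝ, ℝ))) 𝓘(ℝ, ℝ) ∞
      (fun z : ℝ × (X × ℝ) => f z.1 z.2.1 z.2.2)) :
    (Continuous fun p : ℝ × ℝ => ∫ x, f p.1 x p.2 ∂X.haar) ∧
    (Continuous fun p : ℝ × ℝ => ∫ x, deriv (fun r => f r x p.2) p.1 ∂X.haar) ∧
    ∀ s t, HasDerivAt (fun r => ∫ x, f r x t ∂X.haar) (∫ x, deriv (fun r => f r x t) s ∂X.haar) s := by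
  -- The last factor is the variable of differentiation; the first real coordinate is kept as the
  -- point where the derivative is evaluated.
  have hs : ContMDiff ((𝓘(ℝ, ℝ).prod (X.I.prod 𝓘(ℝ, ℝ))).prod 𝓘(ℝ, ℝ)) 𝓘(ℝ, ℝ) ∞
      (fun z : (ℝ × (X × ℝ)) × ℝ => f z.2 z.1.2.1 z.1.2.2) :=
    hf.comp (contMDiff_snd.prodMk (contMDiff_fst.snd))
  have hd : Continuous fun z : ℝ × (X × ℝ) => deriv (fun r => f r z.2.1 z.2.2) z.1 := by
    refine ContMDiff.continuous (I := 𝓘(ℝ, ℝ).prod (X.I.prod 𝓘(ℝ, ℝ))) (I' := 𝓘(ℝ, ℝ))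
      (n := ∞) fun z => ?_
    exact ContMDiffAt.deriv_param (f := fun (z : ℝ × (X × ℝ)) r => f r z.2.1 z.2.2) (g := Prod.fst)
      (hs (z, z.1)) contMDiff_fst.contMDiffAt
  have hr : Continuous fun q : (ℝ × ℝ) × X => (q.1.1, (q.2, q.1.2)) := by fun_prop
  refine ⟨continuous_integral_of_compactSpace (f := fun (p : ℝ × ℝ) x => f p.1 x p.2)
      (hf.continuous.comp hr), continuous_integral_of_compactSpace
        (f := fun (p : ℝ × ℝ) x => deriv (fun r => f r x p.2) p.1) (hd.comp hr), fun s t => ?_⟩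
  refine hasDerivAt_integral_of_compactSpace (f := fun r x => f r x t)
    (f' := fun s x => deriv (fun r => f r x t) s) (fun s => ?_) ?_ (fun s x => ?_) s
  · exact hf.continuous.comp (by fun_prop : Continuous fun x : X => (s, (x, t)))
  · exact hd.comp (by fun_prop : Continuous fun x : ℝ × X => (x.1, (x.2, t)))
  · have : ContMDiff 𝓘(ℝ, ℝ) 𝓘(ℝ, ℝ) ∞ fun r : ℝ => f r x t :=
      hf.comp (contMDiff_id.prodMk (contMDiff_const (c := (x, t))))
    exact (this.contDiff.differentiable (by simp) s).hasDerivAt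

end HaarLieGroup

/-! ### Smooth families of fields and their jets. -/

namespace GFT

open Topology

variable {C : Type w} {M : HaarLieGroup.{u}}

/-- A smooth one-parameter family of field multiplets. -/
def SmoothFamily (Ψ : ℝ → Field C M) : Prop :=
  ∀ c, ContMDiff (𝓘(ℝ, ℝ).prod (M.I.prod 𝓘(ℝ, ℝ))) 𝓘(ℝ, ℂ) ∞
    (fun z : ℝ × (M × ℝ) => Ψ z.1 c z.2.1 z.2.2)

/-- The derivative of a family of fields with respect to the parameter. -/
def variation (Ψ : ℝ → Field C M) (s : ℝ) : Field C M :=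
  fun c g t => deriv (fun r => Ψ r c g t) s

lemma Smooth.family {φ : Field C M} (hφ : Smooth φ) : SmoothFamily fun _ => φ :=
  fun c => (hφ c).comp contMDiff_snd

lemma SmoothFamily.smooth {Ψ : ℝ → Field C M} (hΨ : SmoothFamily Ψ) (s : ℝ) : Smooth (Ψ s) :=
  fun c => (hΨ c).comp (contMDiff_const.prodMk contMDiff_id)

lemma SmoothFamily.variation {Ψ : ℝ → Field C M} (hΨ : SmoothFamily Ψ) :
    SmoothFamily (variation Ψ) := fun c z => by
  have hs : ContMDiff ((𝓘(ℝ, ℝ).prod (M.I.prod 𝓘(ℝ, ℝ))).prod 𝓘(ℝ, ℝ)) 𝓘(ℝ, ℂ) ∞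
      (fun z : (ℝ × (M × ℝ)) × ℝ => Ψ z.2 c z.1.2.1 z.1.2.2) :=
    (hΨ c).comp (contMDiff_snd.prodMk (contMDiff_fst.snd))
  exact ContMDiffAt.deriv_param (f := fun (z : ℝ × (M × ℝ)) r => Ψ r c z.2.1 z.2.2) (g := Prod.fst)
    (hs (z, z.1)) contMDiff_fst.contMDiffAt

lemma SmoothFamily.hasDerivAt {Ψ : ℝ → Field C M} (hΨ : SmoothFamily Ψ) (s : ℝ) (c : C) (g : M)
    (t : ℝ) : HasDerivAt (fun r => Ψ r c g t) (GFT.variation Ψ s c g t) s := by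
  have : ContMDiff 𝓘(ℝ, ℝ) 𝓘(ℝ, ℂ) ∞ fun r : ℝ => Ψ r c g t :=
    (hΨ c).comp (contMDiff_id.prodMk (contMDiff_const (c := (g, t))))
  exact (this.contDiff.differentiable (by simp) s).hasDerivAt

lemma Smooth.contMDiff_slice {φ : Field C M} (hφ : Smooth φ) (c : C) (t : ℝ) :
    ContMDiff M.I 𝓘(ℝ, ℂ) ∞ fun g => φ c g t :=
  (hφ c).comp (contMDiff_id.prodMk contMDiff_const)

lemma Smooth.hasDerivAt {φ : Field C M} (hφ : Smooth φ) (c : C) (g : M) (t : ℝ) :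
    HasDerivAt (fun r => φ c g r) (clockDeriv φ g t c) t := by
  have : ContMDiff 𝓘(ℝ, ℝ) 𝓘(ℝ, ℂ) ∞ fun r : ℝ => φ c g r :=
    (hφ c).comp (contMDiff_const.prodMk contMDiff_id)
  exact (this.contDiff.differentiable (by simp) t).hasDerivAt

/-- The left-trivialised differential in the preferred chart at the identity. -/
lemma leftGrad_eq {q : M → ℂ} (hq : ContMDiff M.I 𝓘(ℝ, ℂ) ∞ q) (g : M) :
    leftGrad q g = fderiv ℝ (fun y => q (g * (extChartAt M.I (1 : M)).symm y))
      (extChartAt M.I (1 : M) 1) := by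
  have h : ContMDiff M.I 𝓘(ℝ, ℂ) ∞ fun h : M => q (g * h) :=
    hq.comp (contMDiff_const.mul contMDiff_id)
  refine (h.mdifferentiable (by simp) 1).mfderiv.trans ?_
  rw [M.boundaryless.range_eq_univ, fderivWithin_univ]
  rfl

/-- Left translation lets the single chart at the identity serve for every `g`, so that derivatives
along `M` become Fréchet derivatives on `M.vec` with `g` as a parameter. -/
lemma contMDiffAt_mul_extChartAt_symm (g : M) :
    ContMDiffAt (M.I.prod 𝓘(ℝ, M.vec)) M.I ∞
      (fun p : M × M.vec => p.1 * (extChartAt M.I (1 : M)).symm p.2)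
      (g, extChartAt M.I (1 : M) 1) := by
  have h : ContMDiffAt 𝓘(ℝ, M.vec) M.I ∞ (extChartAt M.I (1 : M)).symm (extChartAt M.I (1 : M) 1) :=
    (contMDiffOn_extChartAt_symm (1 : M)).contMDiffAt (extChartAt_target_mem_nhds (1 : M))
  exact contMDiffAt_fst.mul (ContMDiffAt.comp (g, extChartAt M.I (1 : M) 1) (f := Prod.snd) h
    contMDiffAt_snd)

lemma SmoothFamily.contMDiff_leftGrad {Ψ : ℝ → Field C M} (hΨ : SmoothFamily Ψ) (c : C) :
    ContMDiff (𝓘(ℝ, ℝ).prod (M.I.prod 𝓘(ℝ, ℝ))) 𝓘(ℝ, M.vec →L[ℝ] ℂ) ∞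
      (fun z : ℝ × (M × ℝ) => leftGrad (fun g => Ψ z.1 c g z.2.2) z.2.1) := fun z => by
  simp only [fun z : ℝ × (M × ℝ) => leftGrad_eq ((hΨ.smooth z.1).contMDiff_slice c z.2.2) z.2.1]
  refine ContMDiffAt.fderiv_param (f := fun (z : ℝ × (M × ℝ)) y =>
    Ψ z.1 c (z.2.1 * (extChartAt M.I (1 : M)).symm y) z.2.2) (g := fun _ => extChartAt M.I (1 : M) 1)
    ?_ contMDiffAt_const
  have h1 := ContMDiffAt.comp (z, extChartAt M.I (1 : M) 1)
    (f := fun p : (ℝ × (M × ℝ)) × M.vec => (p.1.2.1, p.2))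
    (I := (𝓘(ℝ, ℝ).prod (M.I.prod 𝓘(ℝ, ℝ))).prod 𝓘(ℝ, M.vec))
    (contMDiffAt_mul_extChartAt_symm z.2.1)
    (contMDiffAt_fst.snd.fst.prodMk contMDiffAt_snd)
  exact ContMDiffAt.comp (z, extChartAt M.I (1 : M) 1) (hΨ c _)
    (contMDiffAt_fst.fst.prodMk (h1.prodMk contMDiffAt_fst.snd.snd))

/-- In the chart at the identity this is the symmetry of mixed derivatives. -/
lemma SmoothFamily.hasDerivAt_leftGrad {Ψ : ℝ → Field C M} (hΨ : SmoothFamily Ψ) (c : C) (s : ℝ)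
    (g : M) (t : ℝ) : HasDerivAt (fun r => leftGrad (fun g => Ψ r c g t) g)
      (leftGrad (fun g => GFT.variation Ψ s c g t) g) s := by
  rw [leftGrad_eq ((hΨ.variation.smooth s).contMDiff_slice c t) g]
  simp only [fun r => leftGrad_eq ((hΨ.smooth r).contMDiff_slice c t) g]
  refine hasDerivAt_fderiv_comm (f := fun r y => Ψ r c (g * (extChartAt M.I (1 : M)).symm y) t) ?_
  rw [← contMDiffAt_iff_contDiffAt]
  have h1 := ContMDiffAt.comp (s, extChartAt M.I (1 : M) 1) (I := 𝓘(ℝ, ℝ × M.vec))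
    (f := fun p : ℝ × M.vec => (g, p.2))
    (contMDiffAt_mul_extChartAt_symm g)
    (contMDiffAt_const.prodMk contDiff_snd.contMDiff.contMDiffAt)
  exact ContMDiffAt.comp (s, extChartAt M.I (1 : M) 1) (hΨ c _)
    (contDiff_fst.contMDiff.contMDiffAt.prodMk (h1.prodMk contMDiffAt_const))

lemma SmoothFamily.clockDeriv {Ψ : ℝ → Field C M} (hΨ : SmoothFamily Ψ) :
    SmoothFamily fun s c g t => clockDeriv (Ψ s) g t c := fun c z => by
  have hs : ContMDiff ((𝓘(ℝ, ℝ).prod (M.I.prod 𝓘(ℝ, ℝ))).prod 𝓘(ℝ, ℝ)) 𝓘(ℝ, ℂ) ∞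
      (fun z : (ℝ × (M × ℝ)) × ℝ => Ψ z.1.1 c z.1.2.1 z.2) :=
    (hΨ c).comp (contMDiff_fst.fst.prodMk (contMDiff_fst.snd.fst.prodMk contMDiff_snd))
  exact ContMDiffAt.deriv_param (f := fun (z : ℝ × (M × ℝ)) r => Ψ z.1 c z.2.1 r)
    (g := fun z => z.2.2) (hs (z, z.2.2)) contMDiff_snd.snd.contMDiffAt

lemma SmoothFamily.hasDerivAt_clockDeriv {Ψ : ℝ → Field C M} (hΨ : SmoothFamily Ψ) (c : C) (s : ℝ)
    (g : M) (t : ℝ) : HasDerivAt (fun r => GFT.clockDeriv (Ψ r) g t c)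
      (GFT.clockDeriv (GFT.variation Ψ s) g t c) s := by
  have hF : ContDiff ℝ ∞ (fun p : ℝ × ℝ => Ψ p.1 c g p.2) := by
    rw [← contMDiff_iff_contDiff]
    exact (hΨ c).comp (contDiff_fst.contMDiff.prodMk
      (contMDiff_const.prodMk contDiff_snd.contMDiff))
  have := (hasDerivAt_fderiv_comm (f := fun r y => Ψ r c g y) (s := s) (y := t) hF.contDiffAt)
  have := this.clm_apply (hasDerivAt_const s (1 : ℝ))
  simp only [fderiv_eq_smul_deriv, one_smul, map_zero, add_zero] at this
  exact this

variable [Fintype C]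

lemma SmoothFamily.contMDiff_jet {Ψ : ℝ → Field C M} (hΨ : SmoothFamily Ψ) :
    ContMDiff (𝓘(ℝ, ℝ).prod (M.I.prod 𝓘(ℝ, ℝ))) 𝓘(ℝ, Jet C M) ∞
      (fun z : ℝ × (M × ℝ) => jet (Ψ z.1) z.2.1 z.2.2) :=
  contMDiff_snd.snd.prodMk_space ((contMDiff_pi_space.2 hΨ).prodMk_space
    ((contMDiff_pi_space.2 hΨ.contMDiff_leftGrad).prodMk_space (contMDiff_pi_space.2 hΨ.clockDeriv)))

/-- The first entry of a jet is the clock value itself, which does not move with the parameter;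
hence the `0` there. -/
lemma SmoothFamily.hasDerivAt_jet {Ψ : ℝ → Field C M} (hΨ : SmoothFamily Ψ) (s : ℝ) (g : M) (t : ℝ) :
    HasDerivAt (fun r => jet (Ψ r) g t) (0, (jet (GFT.variation Ψ s) g t).2) s :=
  (hasDerivAt_const s t).prodMk ((hasDerivAt_pi.2 fun c => hΨ.hasDerivAt s c g t).prodMk
    ((hasDerivAt_pi.2 fun c => hΨ.hasDerivAt_leftGrad c s g t).prodMk
      (hasDerivAt_pi.2 fun c => hΨ.hasDerivAt_clockDeriv c s g t)))

end GFT

/-- Fubini's theorem for the integral of a continuous function over a slab. -/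
lemma HaarLieGroup.integral_slab (X : HaarLieGroup.{u}) {f : X → ℝ → ℝ}
    (hf : Continuous fun p : X × ℝ => f p.1 p.2) {a b : ℝ} (hab : a ≤ b) :
    ∫ p in univ ×ˢ Icc a b, f p.1 p.2 ∂(X.haar.prod volume) = ∫ t in a..b, ∫ x, f x t ∂X.haar := by
  have hi : IntegrableOn (fun p : X × ℝ => f p.1 p.2) (univ ×ˢ Icc a b) (X.haar.prod volume) :=
    hf.continuousOn.integrableOn_compact (isCompact_univ.prod isCompact_Icc)
  rw [IntegrableOn, ← Measure.prod_restrict, Measure.restrict_univ] at hi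
  rw [← Measure.prod_restrict, Measure.restrict_univ, integral_prod_symm _ hi,
    integral_Icc_eq_integral_Ioc, intervalIntegral.integral_of_le hab]

/-! ### First variation of the action on a slice. -/

namespace GFT

open Topology

variable {C : Type w} [Fintype C] {M : HaarLieGroup.{u}}

namespace Interaction

variable (T : Interaction C M)

lemma lagrangian_contDiff (x : T.Ω) : ContDiff ℝ ∞ (T.lagrangian x) := by
  rw [← contMDiff_iff_contDiff]
  exact T.lagrangian_smooth.comp (contMDiff_const.prodMk contMDiff_id)

/-- The first variation of the Lagrangian of the interaction term. -/
def var (φ δ : Field C M) (x : T.Ω) (t : ℝ) : ℝ :=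
  fderiv ℝ (T.lagrangian x) (t, T.legVals φ x t) (0, T.legVals δ x t)

lemma contMDiff_density {Ψ : ℝ → Field C M} (hΨ : SmoothFamily Ψ) :
    ContMDiff (𝓘(ℝ, ℝ).prod (T.Ω.I.prod 𝓘(ℝ, ℝ))) 𝓘(ℝ, ℝ) ∞
      (fun z : ℝ × (T.Ω × ℝ) => T.lagrangian z.2.1 (z.2.2, T.legVals (Ψ z.1) z.2.1 z.2.2)) := by
  have hv : ContMDiff (𝓘(ℝ, ℝ).prod (T.Ω.I.prod 𝓘(ℝ, ℝ))) 𝓘(ℝ, Fin T.arity → Fib C) ∞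
      (fun z : ℝ × (T.Ω × ℝ) => T.legVals (Ψ z.1) z.2.1 z.2.2) :=
    contMDiff_pi_space.2 fun j => contMDiff_pi_space.2 fun c => (hΨ c).comp
      (contMDiff_fst.prodMk (((T.legs_smooth j).comp contMDiff_snd.fst).prodMk contMDiff_snd.snd))
  exact T.lagrangian_smooth.comp (contMDiff_snd.fst.prodMk (contMDiff_snd.snd.prodMk_space hv))

lemma continuous_density {φ : Field C M} (hφ : Smooth φ) :
    Continuous fun p : T.Ω × ℝ => T.lagrangian p.1 (p.2, T.legVals φ p.1 p.2) :=
  (T.contMDiff_density hφ.family).continuous.comp (by fun_prop : Continuous fun p => ((0 : ℝ), p))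

lemma hasDerivAt_density {Ψ : ℝ → Field C M} (hΨ : SmoothFamily Ψ) (s : ℝ) (x : T.Ω) (t : ℝ) :
    HasDerivAt (fun r => T.lagrangian x (t, T.legVals (Ψ r) x t))
      (T.var (Ψ s) (variation Ψ s) x t) s := by
  refine HasFDerivAt.comp_hasDerivAt s
    (((T.lagrangian_contDiff x).differentiable (by simp) _).hasFDerivAt) ?_
  exact (hasDerivAt_const s t).prodMk (hasDerivAt_pi.2 fun j => hasDerivAt_pi.2 fun c =>
    hΨ.hasDerivAt s c (T.legs j x) t)

lemma integral_density {Ψ : ℝ → Field C M} (hΨ : SmoothFamily Ψ) :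
    (Continuous fun p : ℝ × ℝ =>
      ∫ x, T.lagrangian x (p.2, T.legVals (Ψ p.1) x p.2) ∂T.Ω.haar) ∧
    (Continuous fun p : ℝ × ℝ => ∫ x, T.var (Ψ p.1) (variation Ψ p.1) x p.2 ∂T.Ω.haar) ∧
    ∀ s t, HasDerivAt (fun r => ∫ x, T.lagrangian x (t, T.legVals (Ψ r) x t) ∂T.Ω.haar)
      (∫ x, T.var (Ψ s) (variation Ψ s) x t ∂T.Ω.haar) s := by
  have h := T.Ω.integral_param (f := fun s x t => T.lagrangian x (t, T.legVals (Ψ s) x t))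
    (T.contMDiff_density hΨ)
  simpa only [(T.hasDerivAt_density hΨ _ _ _).deriv] using h

end Interaction

namespace Model

variable (S : Model C M)

lemma locLagrangian_contDiff (g : M) : ContDiff ℝ ∞ (S.locLagrangian g) := by
  rw [← contMDiff_iff_contDiff]
  exact S.locLagrangian_smooth.comp (contMDiff_const.prodMk contMDiff_id)

lemma hasFDerivAt_locLagrangian (g : M) (J : Jet C M) :
    HasFDerivAt (S.locLagrangian g) (fderiv ℝ (S.locLagrangian g) J) J :=
  ((S.locLagrangian_contDiff g).differentiable (by simp) J).hasFDerivAt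

/-- The first variation of the local Lagrangian. -/
def locVar (φ δ : Field C M) (g : M) (t : ℝ) : ℝ :=
  fderiv ℝ (S.locLagrangian g) (jet φ g t) (0, (jet δ g t).2)

/-- The derivative of the local Lagrangian along a field in the direction of a clock velocity. -/
def velPair (φ : Field C M) (g : M) (t : ℝ) (v : Fib C) : ℝ :=
  fderiv ℝ (S.locLagrangian g) (jet φ g t) (0, 0, 0, v)

lemma contMDiff_density {Ψ : ℝ → Field C M} (hΨ : SmoothFamily Ψ) :
    ContMDiff (𝓘(ℝ, ℝ).prod (M.I.prod 𝓘(ℝ, ℝ))) 𝓘(ℝ, ℝ) ∞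
      (fun z : ℝ × (M × ℝ) => S.locLagrangian z.2.1 (jet (Ψ z.1) z.2.1 z.2.2)) :=
  S.locLagrangian_smooth.comp (contMDiff_snd.fst.prodMk hΨ.contMDiff_jet)

lemma continuous_density {φ : Field C M} (hφ : Smooth φ) :
    Continuous fun p : M × ℝ => S.locLagrangian p.1 (jet φ p.1 p.2) :=
  (S.contMDiff_density hφ.family).continuous.comp (by fun_prop : Continuous fun p => ((0 : ℝ), p))

lemma hasDerivAt_density {Ψ : ℝ → Field C M} (hΨ : SmoothFamily Ψ) (s : ℝ) (g : M) (t : ℝ) :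
    HasDerivAt (fun r => S.locLagrangian g (jet (Ψ r) g t))
      (S.locVar (Ψ s) (variation Ψ s) g t) s :=
  (S.hasFDerivAt_locLagrangian g _).comp_hasDerivAt s (hΨ.hasDerivAt_jet s g t)

lemma integral_density {Ψ : ℝ → Field C M} (hΨ : SmoothFamily Ψ) :
    (Continuous fun p : ℝ × ℝ => ∫ g, S.locLagrangian g (jet (Ψ p.1) g p.2) ∂M.haar) ∧
    (Continuous fun p : ℝ × ℝ => ∫ g, S.locVar (Ψ p.1) (variation Ψ p.1) g p.2 ∂M.haar) ∧
    ∀ s t, HasDerivAt (fun r => ∫ g, S.locLagrangian g (jet (Ψ r) g t) ∂M.haar)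
      (∫ g, S.locVar (Ψ s) (variation Ψ s) g t ∂M.haar) s := by
  have h := M.integral_param (f := fun s g t => S.locLagrangian g (jet (Ψ s) g t))
    (S.contMDiff_density hΨ)
  simpa only [(S.hasDerivAt_density hΨ _ _ _).deriv] using h

/-- The first variation of the action on a slice. -/
def sliceVar (φ δ : Field C M) (t : ℝ) : ℝ :=
  (∫ g, S.locVar φ δ g t ∂M.haar) + ∑ i, ∫ x, (S.inter i).var φ δ x t ∂(S.inter i).Ω.haar

/-- Fubini in each term. The action becomes a one-dimensional integral of slice actions, the form in
which both stationarity and symmetry are differentiated. -/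
lemma action_eq {φ : Field C M} (hφ : Smooth φ) {a b : ℝ} (hab : a ≤ b) :
    S.action φ a b = ∫ t in a..b, S.sliceAction φ t := by
  have h0 := M.integral_slab (f := fun g t => S.locLagrangian g (jet φ g t))
    (S.continuous_density hφ) hab
  have h := fun i => (S.inter i).Ω.integral_slab
    (f := fun x t => (S.inter i).lagrangian x (t, (S.inter i).legVals φ x t))
    ((S.inter i).continuous_density hφ) hab
  have hc : Continuous fun t : ℝ => ((0 : ℝ), t) := by fun_prop
  have c0 := (S.integral_density hφ.family).1.comp hc
  have c := fun i => ((S.inter i).integral_density hφ.family).1.comp hc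
  have e : ∀ t, S.sliceAction φ t = (∫ g, S.locLagrangian g (jet φ g t) ∂M.haar) +
    ∑ i, ∫ x, (S.inter i).lagrangian x (t, (S.inter i).legVals φ x t) ∂(S.inter i).Ω.haar :=
    fun t => rfl
  simp only [e]
  simp only [Function.comp_def] at c0 c
  rw [intervalIntegral.integral_add (c0.intervalIntegrable _ _)
    ((continuous_finsetSum _ fun i _ => c i).intervalIntegrable _ _),
    intervalIntegral.integral_finsetSum fun i _ => (c i).intervalIntegrable _ _, ← h0]
  simp only [← h]
  rfl

lemma continuous_sliceAction {Ψ : ℝ → Field C M} (hΨ : SmoothFamily Ψ) :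
    Continuous fun p : ℝ × ℝ => S.sliceAction (Ψ p.1) p.2 :=
  (S.integral_density hΨ).1.add (continuous_finsetSum _ fun i _ =>
    ((S.inter i).integral_density hΨ).1)

lemma continuous_sliceVar {Ψ : ℝ → Field C M} (hΨ : SmoothFamily Ψ) :
    Continuous fun p : ℝ × ℝ => S.sliceVar (Ψ p.1) (variation Ψ p.1) p.2 :=
  (S.integral_density hΨ).2.1.add (continuous_finsetSum _ fun i _ =>
    ((S.inter i).integral_density hΨ).2.1)

lemma hasDerivAt_sliceAction {Ψ : ℝ → Field C M} (hΨ : SmoothFamily Ψ) (s t : ℝ) :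
    HasDerivAt (fun r => S.sliceAction (Ψ r) t) (S.sliceVar (Ψ s) (variation Ψ s) t) s :=
  ((S.integral_density hΨ).2.2 s t).add (HasDerivAt.fun_sum fun i _ =>
    ((S.inter i).integral_density hΨ).2.2 s t)

lemma hasDerivAt_integral_sliceAction {Ψ : ℝ → Field C M} (hΨ : SmoothFamily Ψ) (a b s : ℝ) :
    HasDerivAt (fun r => ∫ t in a..b, S.sliceAction (Ψ r) t)
      (∫ t in a..b, S.sliceVar (Ψ s) (variation Ψ s) t) s :=
  hasDerivAt_intervalIntegral_of_continuous (f := fun r t => S.sliceAction (Ψ r) t)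
    (f' := fun r t => S.sliceVar (Ψ r) (variation Ψ r) t)
    (S.continuous_sliceAction hΨ) (S.continuous_sliceVar hΨ) (S.hasDerivAt_sliceAction hΨ) a b s

lemma velDeriv_eq [DecidableEq C] (c : C) (g : M) (J : Jet C M) (z : ℂ) :
    S.velDeriv c g J z = fderiv ℝ (S.locLagrangian g) J (0, 0, 0, Pi.single c z) := by
  have h1 := (hasFDerivAt_const (𝕜 := ℝ) J.1 J.2.2.2).prodMk
    ((hasFDerivAt_const (𝕜 := ℝ) J.2.1 J.2.2.2).prodMk
      ((hasFDerivAt_const (𝕜 := ℝ) J.2.2.1 J.2.2.2).prodMk (hasFDerivAt_id (𝕜 := ℝ) J.2.2.2)))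
  have h2 := ((S.hasFDerivAt_locLagrangian g J).comp J.2.2.2 h1).fderiv
  -- `velDeriv` is built on classical decidable equality; any two instances agree.
  obtain rfl : (fun a b => Classical.propDecidable (a = b)) = ‹DecidableEq C› := Subsingleton.elim _ _
  exact congrArg (fun A : Fib C →L[ℝ] ℝ => A _) h2

/-- Wirtinger derivatives pair with a complex velocity to the real directional derivative. -/
lemma sum_momentumJet (g : M) (J : Jet C M) (v : Fib C) :
    ∑ c, (S.momentumJet c g J * v c + S.momentumBarJet c g J * (starRingEnd ℂ) (v c)) =
      ((fderiv ℝ (S.locLagrangian g) J (0, 0, 0, v) : ℝ) : ℂ) := by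
  classical
  set D := fderiv ℝ (S.locLagrangian g) J with hD
  set ι : Fib C →L[ℝ] Jet C M := (ContinuousLinearMap.inr ℝ _ _).comp
    ((ContinuousLinearMap.inr ℝ _ _).comp (ContinuousLinearMap.inr ℝ _ _)) with hι
  -- `D` is only real linear, so each colour contributes through its real and imaginary parts
  -- separately.
  have hsum : D (ι v) =
      ∑ c, ((v c).re * D (ι (Pi.single c 1)) + (v c).im * D (ι (Pi.single c Complex.I))) := by
    conv_lhs => rw [← Finset.univ_sum_single v, map_sum, map_sum]
    refine Finset.sum_congr rfl fun c _ => ?_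
    have : (Pi.single c (v c) : Fib C) =
        (v c).re • (Pi.single c 1 : Fib C) + (v c).im • (Pi.single c Complex.I : Fib C) := by
      rw [← Pi.single_smul, ← Pi.single_smul, ← Pi.single_add]
      congr 1
      simp [Complex.re_add_im]
    simp only [this, map_add, map_smul, smul_eq_mul]
  change _ = ((D (ι v) : ℝ) : ℂ)
  rw [hsum, Complex.ofReal_sum]
  refine Finset.sum_congr rfl fun c _ => ?_
  have e : ∀ z, S.velDeriv c g J z = D (ι (Pi.single c z)) := fun z => S.velDeriv_eq c g J z
  rw [momentumJet, momentumBarJet, e, e]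
  -- With `Π = (a - i b) / 2` and `v = x + i y`, the sum `Π v + Π̄ v̄` is `2 Re (Π v) = a x + b y`.
  apply Complex.ext <;> simp <;> ring

lemma sum_mom (φ : Field C M) (g : M) (t : ℝ) (v : Fib C) :
    ∑ c, (S.mom φ c g t * v c + S.momBar φ c g t * (starRingEnd ℂ) (v c)) =
      ((S.velPair φ g t v : ℝ) : ℂ) :=
  S.sum_momentumJet g (jet φ g t) v

end Model

end GFT

/-! ### Momenta and the explicit forms of the charge. -/

namespace GFT

open Topology

variable {C : Type w} [Fintype C] {M : HaarLieGroup.{u}}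

lemma Smooth.contMDiff_jet {φ : Field C M} (hφ : Smooth φ) :
    ContMDiff (M.I.prod 𝓘(ℝ, ℝ)) 𝓘(ℝ, Jet C M) ∞ (fun p : M × ℝ => jet φ p.1 p.2) :=
  hφ.family.contMDiff_jet.comp ((contMDiff_const (c := (0 : ℝ))).prodMk contMDiff_id)

lemma Smooth.contMDiff_val {φ : Field C M} (hφ : Smooth φ) :
    ContMDiff (M.I.prod 𝓘(ℝ, ℝ)) 𝓘(ℝ, Fib C) ∞ (fun p : M × ℝ => val φ p.1 p.2) :=
  contMDiff_pi_space.2 hφ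

namespace Model

variable (S : Model C M)

lemma contMDiff_fderiv_locLagrangian :
    ContMDiff (M.I.prod 𝓘(ℝ, Jet C M)) 𝓘(ℝ, Jet C M →L[ℝ] ℝ) ∞
      (fun p : M × Jet C M => fderiv ℝ (S.locLagrangian p.1) p.2) := fun p => by
  refine ContMDiffAt.fderiv_param (f := fun (p : M × Jet C M) J => S.locLagrangian p.1 J)
    (g := Prod.snd) ?_ contMDiffAt_snd
  exact ContMDiffAt.comp (p, p.2) (S.locLagrangian_smooth _)
    (contMDiffAt_fst.fst.prodMk contMDiffAt_snd)

lemma contMDiff_velPair {φ δ : Field C M} (hφ : Smooth φ) (hδ : Smooth δ) :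
    ContMDiff (M.I.prod 𝓘(ℝ, ℝ)) 𝓘(ℝ, ℝ) ∞
      (fun p : M × ℝ => S.velPair φ p.1 p.2 (val δ p.1 p.2)) := by
  have h1 : ContMDiff (M.I.prod 𝓘(ℝ, ℝ)) 𝓘(ℝ, Jet C M →L[ℝ] ℝ) ∞
      (fun p : M × ℝ => fderiv ℝ (S.locLagrangian p.1) (jet φ p.1 p.2)) :=
    S.contMDiff_fderiv_locLagrangian.comp (contMDiff_fst.prodMk hφ.contMDiff_jet)
  have h2 : ContMDiff (M.I.prod 𝓘(ℝ, ℝ)) 𝓘(ℝ, Jet C M) ∞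
      (fun p : M × ℝ => ((0, 0, 0, val δ p.1 p.2) : Jet C M)) :=
    contMDiff_const.prodMk_space (contMDiff_const.prodMk_space
      (contMDiff_const.prodMk_space hδ.contMDiff_val))
  exact h1.clm_apply h2

lemma velDeriv_jet (φ : Field C M) (c : C) (g : M) (t : ℝ) (z : ℂ) [DecidableEq C] :
    S.velDeriv c g (jet φ g t) z = S.velPair φ g t (Pi.single c z) := by
  rw [velDeriv_eq, velPair]

lemma continuous_velPair {φ : Field C M} (hφ : Smooth φ) (t : ℝ) {v : M → Fib C}
    (hv : Continuous v) : Continuous fun g => S.velPair φ g t (v g) := by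
  have h : Continuous fun g : M => fderiv ℝ (S.locLagrangian g) (jet φ g t) :=
    S.contMDiff_fderiv_locLagrangian.continuous.comp
      (continuous_id.prodMk (hφ.contMDiff_jet.continuous.comp (by fun_prop :
        Continuous fun g : M => (g, t))))
  exact h.clm_apply (by fun_prop)

lemma continuous_mom {φ : Field C M} (hφ : Smooth φ) (c : C) (t : ℝ) :
    Continuous fun g => S.mom φ c g t := by
  classical
  simp only [mom, momentumJet, velDeriv_jet]
  have h := fun z : ℂ => S.continuous_velPair hφ t (v := fun _ => Pi.single c z) continuous_const
  have h1 := h 1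
  have h2 := h Complex.I
  fun_prop

lemma continuous_momBar {φ : Field C M} (hφ : Smooth φ) (c : C) (t : ℝ) :
    Continuous fun g => S.momBar φ c g t := by
  classical
  simp only [momBar, momentumBarJet, velDeriv_jet]
  have h := fun z : ℂ => S.continuous_velPair hφ t (v := fun _ => Pi.single c z) continuous_const
  have h1 := h 1
  have h2 := h Complex.I
  fun_prop

/-- The Wirtinger pairing is real, so the charge is real; conservation is proved for this real
expression. -/
lemma charge_eq (Φ : PointFlow C M) (φ : Field C M) (t : ℝ) :
    S.charge Φ φ t = ((S.sliceAction φ t * Φ.clockGen t +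
      ∫ g, S.velPair φ g t (fun c => Φ.char φ c g t) ∂M.haar : ℝ) : ℂ) := by
  rw [charge, Complex.ofReal_add, ← integral_complex_ofReal]
  congr 2
  funext g
  exact S.sum_mom φ g t fun c => Φ.char φ c g t

/-- The momenta are the fibre derivative of the slice Lagrangian. -/
lemma hasDerivAt_sliceLagrangian {φ : Field C M} (hφ : Smooth φ) (t : ℝ) {v : C → M → ℂ}
    (hv : ∀ c, Continuous (v c)) :
    HasDerivAt (fun s : ℝ => ((S.sliceLagrangian t (slice φ t)
        (fun c g => sliceVel φ t c g + (s : ℂ) * v c g) : ℝ) : ℂ))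
      (∫ g, ∑ c, (S.mom φ c g t * v c g +
        S.momBar φ c g t * (starRingEnd ℂ) (v c g)) ∂M.haar) 0 := by
  set V : M → Jet C M := fun g => (0, 0, 0, fun c => v c g) with hV
  have hVc : Continuous V := by fun_prop
  have hj : Continuous fun g : M => jet φ g t :=
    hφ.contMDiff_jet.continuous.comp (by fun_prop : Continuous fun g : M => (g, t))
  -- A change of velocity moves the jet along a straight line, in its last entry only.
  have hJ : ∀ (s : ℝ) (g : M), sliceJet t (slice φ t) (fun c g => sliceVel φ t c g + (s : ℂ) * v c g) g
      = jet φ g t + s • V g := fun s g => by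
    simp only [jet, sliceJet, hV]
    ext <;> simp
  have hint : HasDerivAt (fun s : ℝ => ∫ g, S.locLagrangian g (jet φ g t + s • V g) ∂M.haar)
      (∫ g, fderiv ℝ (S.locLagrangian g) (jet φ g t + (0 : ℝ) • V g) (V g) ∂M.haar) 0 := by
    refine hasDerivAt_integral_of_compactSpace
      (f := fun s g => S.locLagrangian g (jet φ g t + s • V g))
      (f' := fun s g => fderiv ℝ (S.locLagrangian g) (jet φ g t + s • V g) (V g))
      (fun s => ?_) ?_ (fun s g => ?_) 0
    · exact S.locLagrangian_smooth.continuous.comp (by fun_prop :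
        Continuous fun g : M => (g, jet φ g t + s • V g))
    · have : Continuous fun p : ℝ × M =>
          fderiv ℝ (S.locLagrangian p.2) (jet φ p.2 t + p.1 • V p.2) :=
        S.contMDiff_fderiv_locLagrangian.continuous.comp (by fun_prop :
          Continuous fun p : ℝ × M => (p.2, jet φ p.2 t + p.1 • V p.2))
      exact this.clm_apply (by fun_prop)
    · refine (S.hasFDerivAt_locLagrangian g _).comp_hasDerivAt s ?_
      simpa using ((hasDerivAt_id s).smul_const (V g)).const_add (jet φ g t)
  have e : ∫ g, ∑ c, (S.mom φ c g t * v c g +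
      S.momBar φ c g t * (starRingEnd ℂ) (v c g)) ∂M.haar =
      ((∫ g, fderiv ℝ (S.locLagrangian g) (jet φ g t + (0 : ℝ) • V g) (V g) ∂M.haar : ℝ) : ℂ) := by
    rw [← integral_complex_ofReal]
    refine integral_congr_ae (.of_forall fun g => ?_)
    have e0 : jet φ g t + (0 : ℝ) • V g = jet φ g t :=
      (congrArg (jet φ g t + ·) (zero_smul ℝ (V g))).trans (add_zero _)
    simp only [e0]
    exact S.sum_mom φ g t fun c => v c g
  rw [e]
  refine HasDerivAt.ofReal_comp ?_
  simp only [sliceLagrangian, hJ]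
  exact hint.add_const _

end Model

lemma phaseFlow_char (θ : C → ℝ) (φ : Field C M) (c : C) (g : M) (t : ℝ) :
    (phaseFlow M θ).char φ c g t = Complex.I * θ c * φ c g t := by
  have h : HasDerivAt (fun s : ℝ => Complex.exp (Complex.I * s * θ c) * val φ g t c)
      (Complex.I * θ c * φ c g t) 0 := by
    have h1 := (((Complex.ofRealCLM.hasDerivAt (x := (0 : ℝ))).const_mul Complex.I).mul_const
      (θ c : ℂ)).cexp.mul_const (val φ g t c)
    simpa [val] using h1
  simp only [PointFlow.char, PointFlow.fiberGen, PointFlow.lieDeriv, phaseFlow]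
  rw [h.deriv]
  simp

lemma Model.charge_phaseFlow (S : Model C M) (θ : C → ℝ) {φ : Field C M} (hφ : Smooth φ) (t : ℝ) :
    S.charge (phaseFlow M θ) φ t =
      Complex.I * ∑ c, (θ c : ℂ) * ∫ g, (φ c g t * S.mom φ c g t -
        (starRingEnd ℂ) (φ c g t) * S.momBar φ c g t) ∂M.haar := by
  have h0 : (phaseFlow M θ).clockGen t = 0 := by simp [PointFlow.clockGen, phaseFlow]
  have hi : ∀ c, Integrable (fun g => φ c g t * S.mom φ c g t -
      (starRingEnd ℂ) (φ c g t) * S.momBar φ c g t) M.haar := fun c => by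
    have h1 := (hφ.contMDiff_slice c t).continuous
    have h2 := S.continuous_mom hφ c t
    have h3 := S.continuous_momBar hφ c t
    exact Continuous.integrable_of_compactSpace
      ((h1.mul h2).sub ((Complex.continuous_conj.comp h1).mul h3))
  simp only [charge, h0, phaseFlow_char, mul_zero, Complex.ofReal_zero, zero_add]
  rw [Finset.mul_sum]
  simp only [← integral_const_mul]
  rw [← integral_finsetSum _ fun c _ => ((hi c).const_mul _).const_mul _]
  refine integral_congr_ae (.of_forall fun g => Finset.sum_congr rfl fun c _ => ?_)
  -- Conjugation sends `I * θ` to `-I * θ`, the origin of the minus sign in the charge.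
  simp only [map_mul, Complex.conj_I, Complex.conj_ofReal]
  ring

namespace PointFlow

variable (Φ : PointFlow C M)

lemma contMDiff_base {φ : Field C M} (hφ : Smooth φ) :
    ContMDiff (𝓘(ℝ, ℝ).prod (M.I.prod 𝓘(ℝ, ℝ))) M.I ∞
      (fun z : ℝ × (M × ℝ) => Φ.base z.1 z.2.1 z.2.2 (val φ z.2.1 z.2.2)) :=
  Φ.base_smooth.comp (contMDiff_fst.prodMk (contMDiff_snd.fst.prodMk
    (contMDiff_snd.snd.prodMk_space (hφ.contMDiff_val.comp contMDiff_snd))))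

lemma contMDiff_fiber {φ : Field C M} (hφ : Smooth φ) :
    ContMDiff (𝓘(ℝ, ℝ).prod (M.I.prod 𝓘(ℝ, ℝ))) 𝓘(ℝ, Fib C) ∞
      (fun z : ℝ × (M × ℝ) => Φ.fiber z.1 z.2.1 z.2.2 (val φ z.2.1 z.2.2)) :=
  Φ.fiber_smooth.comp (contMDiff_fst.prodMk (contMDiff_snd.fst.prodMk
    (contMDiff_snd.snd.prodMk_space (hφ.contMDiff_val.comp contMDiff_snd))))

lemma contMDiff_clock :
    ContMDiff (𝓘(ℝ, ℝ).prod (M.I.prod 𝓘(ℝ, ℝ))) 𝓘(ℝ, ℝ) ∞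
      (fun z : ℝ × (M × ℝ) => Φ.clock z.1 z.2.2) :=
  Φ.clock_smooth.contMDiff.comp (contMDiff_fst.prodMk_space contMDiff_snd.snd)

lemma contMDiff_lieDeriv {φ : Field C M} (hφ : Smooth φ) (c : C) :
    ContMDiff (M.I.prod 𝓘(ℝ, ℝ)) 𝓘(ℝ, ℂ) ∞
      (fun p : M × ℝ => Φ.lieDeriv φ (φ c) p.1 p.2) := fun p => by
  refine ContMDiffAt.deriv_param (f := fun (p : M × ℝ) s =>
    φ c (Φ.base s p.1 p.2 (val φ p.1 p.2)) (Φ.clock s p.2)) (g := fun _ => 0) ?_ contMDiffAt_const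
  have h : ContMDiff (𝓘(ℝ, ℝ).prod (M.I.prod 𝓘(ℝ, ℝ))) 𝓘(ℝ, ℂ) ∞ (fun z : ℝ × (M × ℝ) =>
      φ c (Φ.base z.1 z.2.1 z.2.2 (val φ z.2.1 z.2.2)) (Φ.clock z.1 z.2.2)) :=
    (hφ c).comp ((Φ.contMDiff_base hφ).prodMk Φ.contMDiff_clock)
  exact (h.comp (contMDiff_snd.prodMk contMDiff_fst)) _

lemma lieDeriv_conj (φ : Field C M) (q : M → ℝ → ℂ) (g : M) (t : ℝ) :
    Φ.lieDeriv φ (fun h r => (starRingEnd ℂ) (q h r)) g t = (starRingEnd ℂ) (Φ.lieDeriv φ q g t) :=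
  deriv.star

lemma IsPureBase.char_eq {Φ : PointFlow C M} (h : Φ.IsPureBase) (φ : Field C M) (c : C) (g : M)
    (t : ℝ) : Φ.char φ c g t = -Φ.lieDeriv φ (φ c) g t := by
  simp [char, fiberGen, h.2]

end PointFlow

lemma Model.charge_of_isPureBase (S : Model C M) {Φ : PointFlow C M} (h : Φ.IsPureBase)
    {φ : Field C M} (hφ : Smooth φ) (t : ℝ) :
    S.charge Φ φ t =
      -(∫ g, ∑ c, S.mom φ c g t * Φ.lieDeriv φ (φ c) g t ∂M.haar) -
        ∫ g, ∑ c, S.momBar φ c g t *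
          Φ.lieDeriv φ (fun h r => (starRingEnd ℂ) (φ c h r)) g t ∂M.haar := by
  have h0 : Φ.clockGen t = 0 := by simp [PointFlow.clockGen, h.1]
  have hl : ∀ c, Continuous fun g => Φ.lieDeriv φ (φ c) g t := fun c =>
    (Φ.contMDiff_lieDeriv hφ c).continuous.comp (by fun_prop : Continuous fun g : M => (g, t))
  have hm := fun c => S.continuous_mom hφ c t
  have hb := fun c => S.continuous_momBar hφ c t
  have h1 : Integrable (fun g => -∑ c, S.mom φ c g t * Φ.lieDeriv φ (φ c) g t) M.haar :=
    Continuous.integrable_of_compactSpace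
      (continuous_finsetSum _ fun c _ => (hm c).mul (hl c)).neg
  have h2 : Integrable (fun g => ∑ c, S.momBar φ c g t *
      (starRingEnd ℂ) (Φ.lieDeriv φ (φ c) g t)) M.haar :=
    Continuous.integrable_of_compactSpace (continuous_finsetSum _ fun c _ =>
      (hb c).mul (Complex.continuous_conj.comp (hl c)))
  simp only [charge, h0, h.char_eq, mul_zero, Complex.ofReal_zero, zero_add, Φ.lieDeriv_conj]
  rw [← integral_neg, ← integral_sub h1 h2]
  refine integral_congr_ae (.of_forall fun g => ?_)
  simp only [map_neg, mul_neg, Finset.sum_add_distrib, Finset.sum_neg_distrib]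
  ring

lemma Model.charge_translationFlow (S : Model C M) (φ : Field C M) (t : ℝ) :
    S.charge (translationFlow C M) φ t =
      -(∫ g, ∑ c, (S.mom φ c g t * deriv (fun r => φ c g r) t +
        S.momBar φ c g t * deriv (fun r => (starRingEnd ℂ) (φ c g r)) t) ∂M.haar) +
      (S.sliceAction φ t : ℂ) := by
  have h0 : (translationFlow C M).clockGen t = 1 := by
    simp [PointFlow.clockGen, translationFlow]
  have hc : ∀ c g, (translationFlow C M).char φ c g t = -deriv (fun r => φ c g r) t := fun c g => by
    simp only [PointFlow.char, PointFlow.fiberGen, PointFlow.lieDeriv, translationFlow,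
      deriv_const, zero_sub]
    rw [deriv_comp_const_add (f := fun r => φ c g r), add_zero]
  have hs : ∀ c g, deriv (fun r => (starRingEnd ℂ) (φ c g r)) t =
      (starRingEnd ℂ) (deriv (fun r => φ c g r) t) := fun c g =>
    deriv.star
  simp only [charge, h0, hc, hs, mul_one]
  rw [add_comm, ← integral_neg]
  congr 1
  refine integral_congr_ae (.of_forall fun g => ?_)
  simp only [map_neg, mul_neg, ← Finset.sum_neg_distrib]
  exact Finset.sum_congr rfl fun c _ => by ring

/-- Translation of the second coordinate preserves integrals. -/
lemma _root_.HaarLieGroup.setIntegral_translate (X : HaarLieGroup.{u}) (f : X × ℝ → ℝ) (s : ℝ)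
    (A : Set (X × ℝ)) :
    ∫ p in (fun p : X × ℝ => (p.1, p.2 + s)) '' A, f p ∂(X.haar.prod volume) =
      ∫ p in A, f (p.1, p.2 + s) ∂(X.haar.prod volume) :=
  MeasurePreserving.setIntegral_image_emb (f := fun p : X × ℝ => (p.1, p.2 + s))
    ((MeasurePreserving.id X.haar).prod (measurePreserving_add_right volume s))
    ((Homeomorph.refl X).prodCongr (Homeomorph.addRight s)).measurableEmbedding f A

lemma Model.isSymmetry_translationFlow (S : Model C M) (h : S.ClockIndependent) :
    S.IsSymmetry (translationFlow C M) where
  preserves s J _ φ ψ hφ _ hT k hk c g t ht := by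
    have h1 : ∀ g, ψ c g (t + s) = φ c g t := fun g => hT g t ht c
    change ψ c (k g) (t + s) = ψ c g (t + s)
    rw [h1, h1, hφ.2 k hk]
  loc s J hJ φ ψ _ _ hT A hA hAJ := by
    have h1 : ∀ g, ∀ t ∈ J, ∀ c, ψ c g (t + s) = φ c g t := fun g t ht c => hT g t ht c
    refine (M.setIntegral_translate (fun p => S.locLagrangian p.1 (jet ψ p.1 p.2)) s A).trans ?_
    refine setIntegral_congr_fun hA.measurableSet fun p hp => ?_
    have ht : p.2 ∈ J := (hAJ hp).2
    have hj : (jet ψ p.1 (p.2 + s)).2 = (jet φ p.1 p.2).2 := by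
      refine Prod.ext (funext fun c => h1 _ _ ht c) (Prod.ext (funext fun c => ?_) (funext fun c => ?_))
      · change leftGrad (fun g => ψ c g (p.2 + s)) p.1 = leftGrad (fun g => φ c g p.2) p.1
        simp only [h1 _ _ ht c]
      · change deriv (fun r => ψ c p.1 r) (p.2 + s) = deriv (fun r => φ c p.1 r) p.2
        -- The relation between `ψ` and `φ` is known only over `J`; openness of `J` passes it to the
        -- clock derivatives.
        rw [← deriv_comp_add_const (f := fun r => ψ c p.1 r)]
        exact Filter.EventuallyEq.deriv_eq
          (Filter.eventually_of_mem (hJ.mem_nhds ht) fun r hr => h1 p.1 r hr c)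
    exact (h.1 p.1 (p.2 + s) p.2 _ _ _).trans
      (congrArg (fun y => S.locLagrangian p.1 (p.2, y)) hj)
  inter i := by
    -- Translations do not move points of `M`, so the identity of the interaction domain is a lift.
    refine ⟨fun _ x _ _ => x, ⟨contMDiff_snd.fst, fun _ _ _ => rfl, fun _ _ _ _ _ => rfl,
      fun _ _ _ _ _ => rfl⟩, fun s J _ φ ψ _ _ hT A hA hAJ => ?_⟩
    refine ((S.inter i).Ω.setIntegral_translate (fun p => (S.inter i).lagrangian p.1
      (p.2, (S.inter i).legVals ψ p.1 p.2)) s A).trans ?_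
    refine setIntegral_congr_fun hA.measurableSet fun p hp => ?_
    have hv : (S.inter i).legVals ψ p.1 (p.2 + s) = (S.inter i).legVals φ p.1 p.2 :=
      funext fun j => funext fun c => hT ((S.inter i).legs j p.1) p.2 (hAJ hp).2 c
    simp only [hv]
    exact h.2 i p.1 _ _ _

end GFT

/-! ### Smooth dependence of a fixed point on parameters. -/

section FixedPoint

open Topology Metric

variable {F H' E' P : Type*} [NormedAddCommGroup F] [NormedSpace ℝ F] [CompleteSpace F]
  [NormedAddCommGroup E'] [NormedSpace ℝ E'] [CompleteSpace E'] [TopologicalSpace H']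
  {J : ModelWithCorners ℝ E' H'} [J.Boundaryless] [TopologicalSpace P] [ChartedSpace H' P]
  [IsManifold J ∞ P]

/-- The fixed point of a smooth family of contractions of a ball depends smoothly on the
parameter. -/
lemma exists_contMDiffOn_fixedPoint {N : P → F → F}
    (hN : ContMDiff (J.prod 𝓘(ℝ, F)) 𝓘(ℝ, F) ∞ (Function.uncurry N)) {U : Set P} (hU : IsOpen U)
    {B : ℝ} (hN1 : ∀ p ∈ U, ∀ u, ‖u‖ ≤ B → ‖fderiv ℝ (N p) u‖ ≤ 1 / 2)
    (hN2 : ∀ p ∈ U, ∀ u, ‖u‖ ≤ B → ‖N p u‖ < B) (hB : 0 < B) :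
    ∃ v : P → F, ContMDiffOn J 𝓘(ℝ, F) ∞ v U ∧
      (∀ p ∈ U, ‖v p‖ < B ∧ N p (v p) = v p) ∧
      ∀ p ∈ U, ∀ u, ‖u‖ ≤ B → N p u = u → u = v p := by
  have hdiff : ∀ p, ContDiff ℝ ∞ (N p) := fun p => by
    rw [← contMDiff_iff_contDiff]
    exact hN.comp (contMDiff_const.prodMk contMDiff_id)
  have hlip : ∀ p ∈ U, LipschitzOnWith (1 / 2) (N p) (closedBall 0 B) := fun p hp =>
    (convex_closedBall (0 : F) B).lipschitzOnWith_of_nnnorm_fderiv_le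
      (fun u _ => (hdiff p).differentiable (by simp) u)
      (fun u hu => by
        have := hN1 p hp u (by simpa using hu)
        rw [← NNReal.coe_le_coe]
        simpa using this)
  have hmaps : ∀ p ∈ U, MapsTo (N p) (closedBall 0 B) (closedBall 0 B) := fun p hp u hu => by
    simpa using (hN2 p hp u (by simpa using hu)).le
  have hex : ∀ p ∈ U, ∃ u, ‖u‖ ≤ B ∧ N p u = u := fun p hp => by
    have hc : ContractingWith (1 / 2) ((hmaps p hp).restrict (N p) _ _) :=
      ⟨by rw [← NNReal.coe_lt_coe]; norm_num, (hlip p hp).mapsToRestrict (hmaps p hp)⟩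
    obtain ⟨y, hy, hfix, -⟩ := ContractingWith.exists_fixedPoint' isClosed_closedBall.isComplete
      (hmaps p hp) hc (mem_closedBall_self hB.le) (edist_ne_top _ _)
    exact ⟨y, by simpa using hy, hfix⟩
  have huniq : ∀ p ∈ U, ∀ u u', ‖u‖ ≤ B → ‖u'‖ ≤ B → N p u = u → N p u' = u' → u = u' := by
    intro p hp u u' hu hu' h h'
    have h1 := (hlip p hp).dist_le_mul u (by simpa using hu) u' (by simpa using hu')
    rw [h, h'] at h1
    have h2 : dist u u' = 0 := by
      have := dist_nonneg (x := u) (y := u')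
      norm_num at h1
      linarith
    exact dist_eq_zero.1 h2
  choose! v hv1 hv2 using hex
  have hv3 : ∀ p ∈ U, ‖v p‖ < B := fun p hp => by
    have := hN2 p hp (v p) (hv1 p hp)
    rwa [hv2 p hp] at this
  refine ⟨v, fun p hp => ContMDiffAt.contMDiffWithinAt ?_, fun p hp => ⟨hv3 p hp, hv2 p hp⟩,
    fun p hp u hu h => huniq p hp _ _ hu (hv1 p hp) h (hv2 p hp)⟩
  set e := extChartAt J p with he
  -- Smoothness at `p` comes from the implicit function theorem for `u - N u = 0` in a chart: the
  -- partial derivative `1 - N'` is invertible because `N'` has norm at most `1 / 2`.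
  set f : E' × F → F := fun q => q.2 - N (e.symm q.1) q.2 with hf
  have hsymm : ContMDiffAt 𝓘(ℝ, E') J ∞ e.symm (e p) :=
    (contMDiffOn_extChartAt_symm p).contMDiffAt (extChartAt_target_mem_nhds p)
  have hep : e.symm (e p) = p := extChartAt_to_inv p
  have hNf : ContDiffAt ℝ ∞ (fun q : E' × F => N (e.symm q.1) q.2) (e p, v p) := by
    rw [← contMDiffAt_iff_contDiffAt]
    have h1 := ContMDiffAt.comp (e p, v p) (I := 𝓘(ℝ, E' × F)) (f := Prod.fst) hsymm
      contDiff_fst.contMDiff.contMDiffAt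
    exact ContMDiffAt.comp (e p, v p) (hN _) (h1.prodMk contDiff_snd.contMDiff.contMDiffAt)
  have hfc : ContDiffAt ℝ ∞ f (e p, v p) := contDiffAt_snd.sub hNf
  have hpart : fderiv ℝ f (e p, v p) ∘L .inr ℝ E' F = 1 - fderiv ℝ (N p) (v p) := by
    have h1 := HasFDerivAt.comp (g := f) (v p) (hfc.differentiableAt (by simp)).hasFDerivAt
      (hasFDerivAt_prodMk_right (𝕜 := ℝ) (e p) (v p))
    have h2 : HasFDerivAt (fun u => u - N p u) (1 - fderiv ℝ (N p) (v p)) (v p) :=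
      (hasFDerivAt_id (v p)).sub ((hdiff p).differentiable (by simp) (v p)).hasFDerivAt
    refine h1.unique ?_
    simpa [Function.comp_def, hf, hep] using h2
  have hinv : (fderiv ℝ f (e p, v p) ∘L .inr ℝ E' F).IsInvertible := by
    have hlt : ‖fderiv ℝ (N p) (v p)‖ < 1 := (hN1 p hp _ (hv1 p hp)).trans_lt (by norm_num)
    exact ⟨ContinuousLinearEquiv.ofUnit (Units.oneSub _ hlt), hpart.symm⟩
  have hn : (∞ : ℕ∞ω) ≠ 0 := by simp
  set w := hfc.implicitFunction hn hinv with hw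
  have hw0 : w (e p) = v p := hfc.implicitFunction_apply_self hn hinv
  have hwc : ContDiffAt ℝ ∞ w (e p) := hfc.contDiffAt_implicitFunction hn hinv
  have hwe : ∀ᶠ x in 𝓝 (e p), f (x, w x) = f (e p, v p) :=
    hfc.eventually_apply_implicitFunction hn hinv
  have hf0 : f (e p, v p) = 0 := by simp [hf, hep, hv2 p hp]
  have hm : ContMDiffAt J 𝓘(ℝ, F) ∞ (w ∘ e) p :=
    ContMDiffAt.comp p hwc.contMDiffAt contMDiffAt_extChartAt
  refine hm.congr_of_eventuallyEq ?_
  -- The bound `‖v p‖ < B` is strict, so the implicit solution stays in the ball near `p`, where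
  -- uniqueness identifies it with `v`.
  have hball : ∀ᶠ q in 𝓝 p, ‖(w ∘ e) q‖ < B := by
    refine hm.continuousAt.norm.eventually_lt continuousAt_const ?_
    simpa [hw0] using hv3 p hp
  filter_upwards [hU.mem_nhds hp, (continuousAt_extChartAt (I := J) p).eventually hwe, hball,
    extChartAt_source_mem_nhds (I := J) p] with q hqU hq1 hq2 hqs
  refine (huniq q hqU _ _ hq2.le (hv1 q hqU) ?_ (hv2 q hqU)).symm
  rw [hf0] at hq1
  simp only [hf, he] at hq1
  rw [(extChartAt J p).left_inv hqs] at hq1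
  exact (sub_eq_zero.1 hq1).symm

end FixedPoint

/-! ### Existence of transforms for small parameters. -/

namespace GFT

open Topology Metric

variable {C : Type w} [Fintype C] {M : HaarLieGroup.{u}}

namespace PointFlow

variable (Φ : PointFlow C M)

lemma clock_neg (s t : ℝ) : Φ.clock (-s) (Φ.clock s t) = t := by
  rw [← Φ.clock_add, neg_add_cancel, Φ.clock_zero]

lemma clock_neg' (s t : ℝ) : Φ.clock s (Φ.clock (-s) t) = t := by
  rw [← Φ.clock_add, add_neg_cancel, Φ.clock_zero]

lemma base_neg (s : ℝ) (g : M) (t : ℝ) (u : Fib C) :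
    Φ.base (-s) (Φ.base s g t u) (Φ.clock s t) (Φ.fiber s g t u) = g := by
  rw [← Φ.base_add, neg_add_cancel, Φ.base_zero]

lemma base_neg' (s : ℝ) (g : M) (t : ℝ) (u : Fib C) :
    Φ.base s (Φ.base (-s) g t u) (Φ.clock (-s) t) (Φ.fiber (-s) g t u) = g := by
  rw [← Φ.base_add, add_neg_cancel, Φ.base_zero]

lemma fiber_neg (s : ℝ) (g : M) (t : ℝ) (u : Fib C) :
    Φ.fiber (-s) (Φ.base s g t u) (Φ.clock s t) (Φ.fiber s g t u) = u := by
  rw [← Φ.fiber_add, neg_add_cancel, Φ.fiber_zero]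

/-- The fibre map whose fixed point at `(s, (g, t))` is the value at `(g, t)` of the transform of
`φ` with parameter `s`. -/
def pull (φ : Field C M) (p : ℝ × (M × ℝ)) (u : Fib C) : Fib C :=
  u - (Φ.fiber (-p.1) p.2.1 p.2.2 u -
    val φ (Φ.base (-p.1) p.2.1 p.2.2 u) (Φ.clock (-p.1) p.2.2))

/-- At parameter `0` the map is constant in `u`: its derivative vanishes and its value is bounded by
`φ`. By compactness it stays a contraction of a ball for small parameters. -/
lemma pull_zero (φ : Field C M) (y : M × ℝ) (u : Fib C) :
    Φ.pull φ (0, y) u = val φ y.1 y.2 := by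
  simp [pull, Φ.fiber_zero, Φ.base_zero, Φ.clock_zero]

/-- A fixed point is a value `u` for which the inverse transformation carries `(g, t, u)` into the
graph of `φ`. -/
lemma pull_eq_iff (φ : Field C M) (p : ℝ × (M × ℝ)) (u : Fib C) :
    Φ.pull φ p u = u ↔
      val φ (Φ.base (-p.1) p.2.1 p.2.2 u) (Φ.clock (-p.1) p.2.2) = Φ.fiber (-p.1) p.2.1 p.2.2 u := by
  rw [pull, sub_eq_self, sub_eq_zero, eq_comm]

lemma contMDiff_pull {φ : Field C M} (hφ : Smooth φ) :
    ContMDiff ((𝓘(ℝ, ℝ).prod (M.I.prod 𝓘(ℝ, ℝ))).prod 𝓘(ℝ, Fib C)) 𝓘(ℝ, Fib C) ∞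
      (Function.uncurry (Φ.pull φ)) := by
  have hs : ContMDiff ((𝓘(ℝ, ℝ).prod (M.I.prod 𝓘(ℝ, ℝ))).prod 𝓘(ℝ, Fib C)) 𝓘(ℝ, ℝ) ∞
      (fun q : (ℝ × (M × ℝ)) × Fib C => -q.1.1) := contMDiff_fst.fst.neg
  have hg : ContMDiff ((𝓘(ℝ, ℝ).prod (M.I.prod 𝓘(ℝ, ℝ))).prod 𝓘(ℝ, Fib C)) M.I ∞
      (fun q : (ℝ × (M × ℝ)) × Fib C => q.1.2.1) := contMDiff_fst.snd.fst
  have ht : ContMDiff ((𝓘(ℝ, ℝ).prod (M.I.prod 𝓘(ℝ, ℝ))).prod 𝓘(ℝ, Fib C)) 𝓘(ℝ, ℝ) ∞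
      (fun q : (ℝ × (M × ℝ)) × Fib C => q.1.2.2) := contMDiff_fst.snd.snd
  have hu : ContMDiff ((𝓘(ℝ, ℝ).prod (M.I.prod 𝓘(ℝ, ℝ))).prod 𝓘(ℝ, Fib C)) 𝓘(ℝ, Fib C) ∞
      (fun q : (ℝ × (M × ℝ)) × Fib C => q.2) := contMDiff_snd
  have harg := hs.prodMk (hg.prodMk (ht.prodMk_space hu))
  have hf := Φ.fiber_smooth.comp harg
  have hb := Φ.base_smooth.comp harg
  have hc := Φ.clock_smooth.contMDiff.comp (hs.prodMk_space ht)
  exact hu.sub (hf.sub (hφ.contMDiff_val.comp (hb.prodMk hc)))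

end PointFlow

/-- Cutting off a locally defined family of fields. -/
lemma contMDiff_bump_smul {v : ℝ × (M × ℝ) → Fib C} {r R : ℝ}
    (hv : ContMDiffOn (𝓘(ℝ, ℝ).prod (M.I.prod 𝓘(ℝ, ℝ))) 𝓘(ℝ, Fib C) ∞ v
      {z | |z.1| < r ∧ |z.2.2| < R}) (κ l : ContDiffBump (0 : ℝ)) (hκ : κ.rOut < r)
    (hl : l.rOut < R) :
    ContMDiff (𝓘(ℝ, ℝ).prod (M.I.prod 𝓘(ℝ, ℝ))) 𝓘(ℝ, Fib C) ∞
      (fun z : ℝ × (M × ℝ) => (κ z.1 * l z.2.2) • v z) := fun z => by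
  have h1 : Continuous fun z : ℝ × (M × ℝ) => |z.1| := by fun_prop
  have h2 : Continuous fun z : ℝ × (M × ℝ) => |z.2.2| := by fun_prop
  have hzero : (∀ᶠ y in 𝓝 z, κ y.1 * l y.2.2 = 0) →
      ContMDiffAt (𝓘(ℝ, ℝ).prod (M.I.prod 𝓘(ℝ, ℝ))) 𝓘(ℝ, Fib C) ∞
        (fun z : ℝ × (M × ℝ) => (κ z.1 * l z.2.2) • v z) z := fun h =>
    (contMDiffAt_const (c := (0 : Fib C))).congr_of_eventuallyEq
      (h.mono fun y hy => by simp only [hy, zero_smul])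
  rcases lt_or_ge κ.rOut |z.1| with hz | hz
  · refine hzero ((h1.continuousAt.eventually (lt_mem_nhds hz)).mono fun y hy => ?_)
    rw [κ.zero_of_le_dist (by simpa using hy.le), zero_mul]
  rcases lt_or_ge l.rOut |z.2.2| with hz' | hz'
  · refine hzero ((h2.continuousAt.eventually (lt_mem_nhds hz')).mono fun y hy => ?_)
    rw [l.zero_of_le_dist (by simpa using hy.le), mul_zero]
  have hU : IsOpen {z : ℝ × (M × ℝ) | |z.1| < r ∧ |z.2.2| < R} :=
    (isOpen_lt h1 continuous_const).inter (isOpen_lt h2 continuous_const)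
  have hvz := hv.contMDiffAt (hU.mem_nhds ⟨hz.trans_lt hκ, hz'.trans_lt hl⟩)
  have hk : ContMDiff (𝓘(ℝ, ℝ).prod (M.I.prod 𝓘(ℝ, ℝ))) 𝓘(ℝ, ℝ) ∞
      (fun z : ℝ × (M × ℝ) => κ z.1) := κ.contDiff.contMDiff.comp contMDiff_fst
  have hll : ContMDiff (𝓘(ℝ, ℝ).prod (M.I.prod 𝓘(ℝ, ℝ))) 𝓘(ℝ, ℝ) ∞
      (fun z : ℝ × (M × ℝ) => l z.2.2) := l.contDiff.contMDiff.comp contMDiff_snd.snd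
  exact ((hk z).mul (hll z)).smul hvz

/-- Transforms of a field exist for small values of the parameter, over bounded intervals of the
clock variable, and depend smoothly on the parameter. -/
lemma PointFlow.exists_transforms (Φ : PointFlow C M) {φ : Field C M} (hφ : Smooth φ) {R : ℝ}
    (hR : 0 < R) :
    ∃ Ψ : ℝ → Field C M, SmoothFamily Ψ ∧ Ψ 0 = φ ∧
      ∀ᶠ s in 𝓝 (0 : ℝ), Φ.Transforms s (Ioo (-R) R) φ (Ψ s) ∧
        Φ.Transforms (-s) (Φ.clock s '' Ioo (-R) R) (Ψ s) φ := by
  have hcφ := hφ.contMDiff_val.continuous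
  obtain ⟨B₀, hB₀⟩ := ((isCompact_univ (X := M)).prod
    (isCompact_Icc (a := -(R + 3)) (b := R + 3))).bddAbove_image hcφ.norm.continuousOn
  have hφB : ∀ g t, |t| ≤ R + 3 → ‖val φ g t‖ < max B₀ 0 + 1 := fun g t ht => by
    have : ‖val φ g t‖ ≤ B₀ := hB₀ (mem_image_of_mem (fun p : M × ℝ => ‖val φ p.1 p.2‖)
      (mk_mem_prod (mem_univ g) (abs_le.1 ht)))
    exact (this.trans (le_max_left _ _)).trans_lt (lt_add_one _)
  set B := max B₀ 0 + 1 with hB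
  have hB0 : 0 < B := by positivity
  have hN := Φ.contMDiff_pull hφ
  have hD : Continuous fun q : (ℝ × (M × ℝ)) × Fib C => fderiv ℝ (Φ.pull φ q.1) q.2 := by
    refine ContMDiff.continuous (I := (𝓘(ℝ, ℝ).prod (M.I.prod 𝓘(ℝ, ℝ))).prod 𝓘(ℝ, Fib C))
      (I' := 𝓘(ℝ, Fib C →L[ℝ] Fib C)) (n := ∞) fun q => ?_
    refine ContMDiffAt.fderiv_param (f := fun (q : (ℝ × (M × ℝ)) × Fib C) u => Φ.pull φ q.1 u)
      (g := Prod.snd) ?_ contMDiffAt_snd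
    exact ContMDiffAt.comp (q, q.2) (hN _) (contMDiffAt_fst.fst.prodMk contMDiffAt_snd)
  have ev1 : ∀ᶠ s in 𝓝 (0 : ℝ), ∀ y ∈ (univ ×ˢ Icc (-(R + 3)) (R + 3)) ×ˢ closedBall (0 : Fib C) B,
      ‖fderiv ℝ (Φ.pull φ (s, y.1)) y.2‖ < 1 / 2 ∧ ‖Φ.pull φ (s, y.1) y.2‖ < B := by
    refine IsCompact.eventually_forall_of_forall_eventually ((isCompact_univ.prod isCompact_Icc).prod
      (isCompact_closedBall _ _)) fun y hy => ?_
    have hr : Continuous fun z : ℝ × ((M × ℝ) × Fib C) => ((z.1, z.2.1), z.2.2) := by fun_prop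
    refine ((hD.comp hr).norm.continuousAt.eventually_lt continuousAt_const ?_).and
      ((hN.continuous.comp hr).norm.continuousAt.eventually_lt continuousAt_const ?_)
    · have : Φ.pull φ (0, y.1) = fun _ => val φ y.1.1 y.1.2 := funext fun u => Φ.pull_zero φ y.1 u
      simp [this]
    · simpa [Φ.pull_zero] using hφB y.1.1 y.1.2 (abs_le.2 hy.1.2)
  obtain ⟨δ, hδ, hδ1⟩ := Metric.eventually_nhds_iff.1 ev1
  set U : Set (ℝ × (M × ℝ)) := {z | |z.1| < δ ∧ |z.2.2| < R + 3} with hU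
  have hUo : IsOpen U :=
    (isOpen_lt (by fun_prop : Continuous fun z : ℝ × (M × ℝ) => |z.1|) continuous_const).inter
      (isOpen_lt (by fun_prop : Continuous fun z : ℝ × (M × ℝ) => |z.2.2|) continuous_const)
  have hUB : ∀ p ∈ U, ∀ u : Fib C, ‖u‖ ≤ B →
      ‖fderiv ℝ (Φ.pull φ p) u‖ < 1 / 2 ∧ ‖Φ.pull φ p u‖ < B := fun p hp u hu =>
    hδ1 (y := p.1) (by simpa using hp.1) (p.2, u)
      ⟨⟨mem_univ _, abs_le.1 hp.2.le⟩, by simpa using hu⟩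
  obtain ⟨v, hv, hv1, hv2⟩ := exists_contMDiffOn_fixedPoint hN hUo
    (fun p hp u hu => (hUB p hp u hu).1.le) (fun p hp u hu => (hUB p hp u hu).2) hB0
  -- Cut-offs extend `v` from `U` to all parameters, interpolating with `φ`. They equal `1` for `|s|
  -- ≤ δ / 4` and `|t| ≤ R + 1`, and vanish from `δ / 2` and `R + 2` on, strictly inside `U`.
  let κ : ContDiffBump (0 : ℝ) := ⟨δ / 4, δ / 2, by linarith, by linarith⟩
  let l : ContDiffBump (0 : ℝ) := ⟨R + 1, R + 2, by linarith, by linarith⟩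
  have hφU : ContMDiff (𝓘(ℝ, ℝ).prod (M.I.prod 𝓘(ℝ, ℝ))) 𝓘(ℝ, Fib C) ∞
      (fun z : ℝ × (M × ℝ) => val φ z.2.1 z.2.2) := hφ.contMDiff_val.comp contMDiff_snd
  have hsm := hφU.add (contMDiff_bump_smul (hv.sub hφU.contMDiffOn) κ l
    (show δ / 2 < δ by linarith) (show R + 2 < R + 3 by linarith))
  set Ψ : ℝ → Field C M := fun s c g t =>
    (val φ g t + (κ s * l t) • (v (s, (g, t)) - val φ g t)) c with hΨ
  have hΨv : ∀ s g t, |s| ≤ δ / 4 → |t| ≤ R + 1 → val (Ψ s) g t = v (s, (g, t)) := by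
    intro s g t hs ht
    have h1 : κ s = 1 := κ.one_of_mem_closedBall (by simpa using hs)
    have h2 : l t = 1 := l.one_of_mem_closedBall (by simpa using ht)
    change val φ g t + (κ s * l t) • (v (s, (g, t)) - val φ g t) = _
    rw [h1, h2, mul_one, one_smul, add_sub_cancel]
  refine ⟨Ψ, fun c => contMDiff_pi_space.1 hsm c, ?_, ?_⟩
  · funext c g t
    rcases lt_or_ge |t| (R + 3) with ht | ht
    · have hp : ((0 : ℝ), (g, t)) ∈ U := ⟨by simpa using hδ, ht⟩
      have := (hv1 _ hp).2
      rw [Φ.pull_zero] at this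
      simp [hΨ, ← this, val]
    · have h2 : l t = 0 := l.zero_of_le_dist (by
        rw [Real.dist_0_eq_abs]; exact (show R + 2 ≤ R + 3 by linarith).trans ht)
      simp [hΨ, h2, val]
  -- For small `s` the transformed graph over `(-R, R)` lies where the cut-off is `1` and where its
  -- values are in the ball of uniqueness.
  have ev2 : ∀ᶠ s in 𝓝 (0 : ℝ), ∀ y ∈ univ ×ˢ Icc (-R) R,
      |Φ.clock s y.2| < R + 1 ∧ ‖Φ.fiber s y.1 y.2 (val φ y.1 y.2)‖ < B := by
    refine IsCompact.eventually_forall_of_forall_eventually (isCompact_univ.prod isCompact_Icc)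
      fun y hy => ?_
    have hy2 : |y.2| ≤ R := abs_le.2 hy.2
    refine (Φ.contMDiff_clock.continuous.abs.continuousAt.eventually_lt continuousAt_const ?_).and
      ((Φ.contMDiff_fiber hφ).continuous.norm.continuousAt.eventually_lt continuousAt_const ?_)
    · simp only [Φ.clock_zero]
      linarith
    · simp only [Φ.fiber_zero]
      exact hφB _ _ (by linarith)
  have ev3 : ∀ᶠ s in 𝓝 (0 : ℝ), |s| < δ / 4 :=
    continuous_abs.continuousAt.eventually_lt continuousAt_const (by simpa using hδ)
  filter_upwards [ev2, ev3] with s hs hs'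
  have hmem : ∀ (g : M), ∀ t ∈ Ioo (-R) R, (s, (g, Φ.clock s t)) ∈ U := fun g t ht =>
    ⟨by linarith, by linarith [(hs (g, t) ⟨mem_univ _, Ioo_subset_Icc_self ht⟩).1]⟩
  refine ⟨fun g t ht c => ?_, ?_⟩
  · have h := hs (g, t) ⟨mem_univ _, Ioo_subset_Icc_self ht⟩
    have e := hΨv s (Φ.base s g t (val φ g t)) (Φ.clock s t) hs'.le h.1.le
    -- The transformed value solves the fixed point equation at the transformed point, so by
    -- uniqueness it is `v` there.
    have e2 := hv2 _ (hmem (Φ.base s g t (val φ g t)) t ht) (Φ.fiber s g t (val φ g t)) h.2.le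
      ((Φ.pull_eq_iff φ _ _).2 (by simp only [Φ.base_neg, Φ.clock_neg, Φ.fiber_neg]))
    exact congrFun (e.trans e2.symm) c
  · rintro g _ ⟨t, ht, rfl⟩ c
    have h := hs (g, t) ⟨mem_univ _, Ioo_subset_Icc_self ht⟩
    rw [hΨv s g _ hs'.le h.1.le]
    exact congrFun ((Φ.pull_eq_iff φ _ _).1 (hv1 _ (hmem g t ht)).2) c

end GFT

/-! ### Infinitesimal transforms and invariance of the action over slabs. -/

namespace GFT

open Topology

variable {C : Type w} [Fintype C] {M : HaarLieGroup.{u}}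

namespace PointFlow

variable (Φ : PointFlow C M)

/-- Each `clock r` is injective, with inverse `clock (-r)`. By the intermediate value theorem in
`r`, the difference of the images of two points cannot change sign on the way from the identity. -/
lemma clock_strictMono (s : ℝ) : StrictMono (Φ.clock s) := by
  intro a b hab
  by_contra! h
  have hc : Continuous fun r => Φ.clock r b - Φ.clock r a := by
    have := Φ.clock_smooth.continuous
    exact (this.comp (by fun_prop : Continuous fun r : ℝ => (r, b))).sub
      (this.comp (by fun_prop : Continuous fun r : ℝ => (r, a)))
  obtain ⟨r, hr⟩ := mem_range_of_exists_le_of_exists_ge hc (c := 0) ⟨s, by linarith⟩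
    ⟨0, by rw [Φ.clock_zero, Φ.clock_zero]; linarith⟩
  have h1 : Φ.clock r b = Φ.clock r a := sub_eq_zero.1 hr
  have h2 := congrArg (Φ.clock (-r)) h1
  rw [Φ.clock_neg, Φ.clock_neg] at h2
  exact hab.ne' h2

lemma hasDerivAt_clock (t : ℝ) : HasDerivAt (fun s => Φ.clock s t) (Φ.clockGen t) 0 := by
  have : ContDiff ℝ ∞ fun s => Φ.clock s t :=
    Φ.clock_smooth.comp (contDiff_id.prodMk contDiff_const)
  exact (this.differentiable (by simp) 0).hasDerivAt

/-- Clock values in a bounded interval move little under transformations with small parameter. -/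
lemma eventually_clock_mem {R R' : ℝ} (h : R < R') :
    ∀ᶠ s in 𝓝 (0 : ℝ), ∀ t, |t| ≤ R → |Φ.clock s t| < R' ∧ |Φ.clock (-s) t| < R' := by
  have h1 : ∀ᶠ s in 𝓝 (0 : ℝ), ∀ t ∈ Icc (-R) R, |Φ.clock s t| < R' := by
    refine isCompact_Icc.eventually_forall_of_forall_eventually fun t ht => ?_
    refine Φ.clock_smooth.continuous.abs.continuousAt.eventually_lt continuousAt_const ?_
    rw [Φ.clock_zero]
    exact (abs_le.2 ht).trans_lt h
  have h2 : ∀ᶠ s in 𝓝 (0 : ℝ), ∀ t ∈ Icc (-R) R, |Φ.clock (-s) t| < R' :=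
    (continuous_neg.tendsto' 0 0 neg_zero).eventually h1
  filter_upwards [h1, h2] with s hs hs' t ht
  exact ⟨hs t (abs_le.1 ht), hs' t (abs_le.1 ht)⟩

/-- The derivative at the identity of the transforms of a field is the characteristic. -/
lemma variation_eq_char {φ : Field C M} {Ψ : ℝ → Field C M} (hΨ : SmoothFamily Ψ)
    (h0 : Ψ 0 = φ) {J : Set ℝ} (hT : ∀ᶠ s in 𝓝 (0 : ℝ), Φ.Transforms s J φ (Ψ s)) (c : C) (g : M)
    {t : ℝ} (ht : t ∈ J) : variation Ψ 0 c g t = Φ.char φ c g t := by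
  have hφ : Smooth φ := h0 ▸ hΨ.smooth 0
  -- The parameter of the family and that of the base motion are separated. The diagonal derivative
  -- is `X_V` by the transformation law; the partial derivatives are the variation and the Lie
  -- derivative of `φ`.
  have hF : ContDiff ℝ ∞ (fun p : ℝ × ℝ =>
      Ψ p.1 c (Φ.base p.2 g t (val φ g t)) (Φ.clock p.2 t)) := by
    rw [← contMDiff_iff_contDiff]
    have hs : ContMDiff 𝓘(ℝ, ℝ × ℝ) (𝓘(ℝ, ℝ).prod (M.I.prod 𝓘(ℝ, ℝ))) ∞
        (fun p : ℝ × ℝ => (p.2, (g, t))) := contDiff_snd.contMDiff.prodMk contMDiff_const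
    exact (hΨ c).comp (contDiff_fst.contMDiff.prodMk
      (((Φ.contMDiff_base hφ).comp hs).prodMk (Φ.contMDiff_clock.comp hs)))
  have hd := (hF.differentiable (by simp) (0, 0)).hasFDerivAt
  have h1 := hd.comp_hasDerivAt (f := fun r : ℝ => (r, (0 : ℝ))) (0 : ℝ)
    ((hasDerivAt_id' (0 : ℝ)).prodMk (hasDerivAt_const 0 (0 : ℝ)))
  have h2 := hd.comp_hasDerivAt (f := fun r : ℝ => ((0 : ℝ), r)) (0 : ℝ)
    ((hasDerivAt_const (0 : ℝ) (0 : ℝ)).prodMk (hasDerivAt_id' 0))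
  have h3 := hd.comp_hasDerivAt (f := fun r : ℝ => (r, r)) (0 : ℝ)
    ((hasDerivAt_id' (0 : ℝ)).prodMk (hasDerivAt_id' 0))
  have e1 := h1.deriv
  have e2 := h2.deriv
  have e3 := h3.deriv
  have e4 : Φ.fiberGen φ c g t = deriv (fun r => Ψ r c (Φ.base r g t (val φ g t)) (Φ.clock r t)) 0 :=
    Filter.EventuallyEq.deriv_eq (hT.mono fun s hs => (hs g t ht c).symm)
  simp only [Function.comp_def, Φ.base_zero, Φ.clock_zero, h0] at e1 e2 e3
  change variation Ψ 0 c g t = _ at e1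
  change Φ.lieDeriv φ (φ c) g t = _ at e2
  rw [char, e4, e1, e2, e3, ← map_sub]
  simp

end PointFlow

namespace Model

variable (S : Model C M)

/-- A symmetry gives the constraints for the transform only over transformed clock values, so a
second cut-off returns to `φ` outside. It depends on `t` alone and is thus compatible with
constraints, which act on `M`. The margin `R + 3` makes every `t` with `|t| ≤ R + 2` a transformed
clock value. -/
lemma IsSymmetry.exists_transforms {S : Model C M} {Φ : PointFlow C M} (hS : S.IsSymmetry Φ)
    {φ : Field C M} (hφ : S.Admissible φ) {R : ℝ} (hR : 0 < R) :
    ∃ Ψ : ℝ → Field C M, SmoothFamily Ψ ∧ Ψ 0 = φ ∧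
      ∀ᶠ s in 𝓝 (0 : ℝ), S.Admissible (Ψ s) ∧ Φ.Transforms s (Ioo (-R) R) φ (Ψ s) ∧
        Φ.Transforms (-s) (Φ.clock s '' Ioo (-R) R) (Ψ s) φ := by
  obtain ⟨Ξ, hΞ, hΞ0, hT⟩ := Φ.exists_transforms hφ.1 (show 0 < R + 3 by linarith)
  let l : ContDiffBump (0 : ℝ) := ⟨R + 1, R + 2, by linarith, by linarith⟩
  set Ψ : ℝ → Field C M := fun s c g t => φ c g t + l t • (Ξ s c g t - φ c g t) with hΨ
  have hl : ContMDiff (𝓘(ℝ, ℝ).prod (M.I.prod 𝓘(ℝ, ℝ))) 𝓘(ℝ, ℝ) ∞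
      (fun z : ℝ × (M × ℝ) => l z.2.2) := l.contDiff.contMDiff.comp contMDiff_snd.snd
  have hΨs : SmoothFamily Ψ := fun c =>
    (hφ.1.family c).add (hl.smul ((hΞ c).sub (hφ.1.family c)))
  have hΨΞ : ∀ s c g t, |t| ≤ R + 1 → Ψ s c g t = Ξ s c g t := fun s c g t ht => by
    have h1 : l t = 1 := l.one_of_mem_closedBall (by simpa using ht)
    simp [hΨ, h1]
  refine ⟨Ψ, hΨs, by simp [hΨ, hΞ0], ?_⟩
  filter_upwards [hT, Φ.eventually_clock_mem (show R < R + 1 by linarith),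
    Φ.eventually_clock_mem (show R + 2 < R + 3 by linarith)] with s hs hs1 hs2
  have hcl : ∀ t ∈ Ioo (-R) R, |Φ.clock s t| ≤ R + 1 := fun t ht => (hs1 t (abs_lt.2 ht).le).1.le
  have hsub : Ioo (-R) R ⊆ Ioo (-(R + 3)) (R + 3) := Ioo_subset_Ioo (by linarith) (by linarith)
  refine ⟨⟨hΨs.smooth s, fun k hk c g t => ?_⟩, fun g t ht c => ?_, ?_⟩
  · rcases le_or_gt |t| (R + 2) with ht | ht
    · have h1 := hS.preserves s _ isOpen_Ioo φ (Ξ s) hφ (hΞ.smooth s) hs.1 k hk c g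
        (Φ.clock (-s) t) (abs_lt.1 (hs2 t ht).2)
      rw [Φ.clock_neg'] at h1
      simp only [hΨ, h1, hφ.2 k hk]
    · have h1 : l t = 0 := l.zero_of_le_dist (by simpa using ht.le)
      simp only [hΨ, h1, zero_smul, hφ.2 k hk]
  · rw [hΨΞ _ _ _ _ (hcl t ht)]
    exact hs.1 g t (hsub ht) c
  · rintro g _ ⟨t, ht, rfl⟩ c
    have : val (Ψ s) g (Φ.clock s t) = val (Ξ s) g (Φ.clock s t) :=
      funext fun c => hΨΞ _ _ _ _ (hcl t ht)
    rw [this]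
    exact hs.2 g _ ⟨t, hsub ht, rfl⟩ c

/-- The action over a slab is carried to the action over the transformed slab. -/
lemma IsSymmetry.action_eq {S : Model C M} {Φ : PointFlow C M} (hS : S.IsSymmetry Φ) {s : ℝ}
    {J : Set ℝ} (hJ : IsOpen J) {φ ψ : Field C M} (hφ : S.Admissible φ) (hψ : S.Admissible ψ)
    (hT : Φ.Transforms s J φ ψ) (hT' : Φ.Transforms (-s) (Φ.clock s '' J) ψ φ) {a b : ℝ}
    (hab : Icc a b ⊆ J) : S.action ψ (Φ.clock s a) (Φ.clock s b) = S.action φ a b := by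
  have hinv : ∀ t ∈ Icc (Φ.clock s a) (Φ.clock s b), Φ.clock (-s) t ∈ Icc a b := fun t ht => by
    have h1 := (Φ.clock_strictMono (-s)).monotone ht.1
    have h2 := (Φ.clock_strictMono (-s)).monotone ht.2
    rw [Φ.clock_neg] at h1 h2
    exact ⟨h1, h2⟩
  have hmono : ∀ t ∈ Icc a b, Φ.clock s t ∈ Icc (Φ.clock s a) (Φ.clock s b) := fun t ht =>
    ⟨(Φ.clock_strictMono s).monotone ht.1, (Φ.clock_strictMono s).monotone ht.2⟩
  have hval : ∀ g, ∀ t ∈ Icc (Φ.clock s a) (Φ.clock s b),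
      val φ (Φ.base (-s) g t (val ψ g t)) (Φ.clock (-s) t) = Φ.fiber (-s) g t (val ψ g t) :=
    fun g t ht => funext fun c => hT' g t ⟨_, hab (hinv t ht), Φ.clock_neg' s t⟩ c
  -- The slab is covered because the inverse transformation, applied along `ψ`, supplies preimages.
  have himg : Φ.baseMap s φ '' (univ ×ˢ Icc a b) = univ ×ˢ Icc (Φ.clock s a) (Φ.clock s b) := by
    ext ⟨g, t⟩
    constructor
    · rintro ⟨p, hp, h⟩
      rw [← h]
      exact ⟨mem_univ _, hmono _ hp.2⟩
    · rintro ⟨-, ht⟩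
      refine ⟨(Φ.base (-s) g t (val ψ g t), Φ.clock (-s) t), ⟨mem_univ _, hinv t ht⟩, ?_⟩
      simp only [PointFlow.baseMap, hval g t ht, Φ.base_neg', Φ.clock_neg']
  have hsub : ∀ X : Type u, (univ : Set X) ×ˢ Icc a b ⊆ univ ×ˢ J :=
    fun X => prod_mono_right hab
  refine congrArg₂ (· + ·) ?_ (Finset.sum_congr rfl fun i _ => ?_)
  · rw [← himg]
    exact hS.loc s J hJ φ ψ hφ hψ hT _ (isCompact_univ.prod isCompact_Icc) (hsub _)
  · obtain ⟨K, hK, hKS⟩ := hS.inter i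
    rw [← hKS s J hJ φ ψ hφ hψ hT _ (isCompact_univ.prod isCompact_Icc) (hsub _)]
    congr 1
    symm
    ext ⟨x, t⟩
    constructor
    · rintro ⟨p, hp, h⟩
      rw [← h]
      exact ⟨mem_univ _, hmono _ hp.2⟩
    · rintro ⟨-, ht⟩
      refine ⟨(K (-s) x t ((S.inter i).legVals ψ x t), Φ.clock (-s) t), ⟨mem_univ _, hinv t ht⟩, ?_⟩
      -- Compatibility of the lift with the legs identifies the field values at the pulled-back
      -- point, after which the group law of `K` makes `K (-s)` the inverse.
      have hleg : (S.inter i).legVals φ (K (-s) x t ((S.inter i).legVals ψ x t)) (Φ.clock (-s) t) =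
          fun j => Φ.fiber (-s) ((S.inter i).legs j x) t ((S.inter i).legVals ψ x t j) :=
        funext fun j => by
          rw [Interaction.legVals, hK.legs]
          exact hval _ t ht
      simp only [hleg]
      rw [← hK.add, add_neg_cancel, hK.zero, Φ.clock_neg']

end Model

end GFT

/-! ### Conservation on shell. -/

namespace GFT

open Topology

variable {C : Type w} {M : HaarLieGroup.{u}}

/-- The product of a field multiplet with a function of the clock variable. -/
def cut (χ : ℝ → ℝ) (δ : Field C M) : Field C M := fun c g t => χ t • δ c g t

lemma Smooth.cut {δ : Field C M} (hδ : Smooth δ) {χ : ℝ → ℝ} (hχ : ContDiff ℝ ∞ χ) :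
    Smooth (cut χ δ) := fun c =>
  ContMDiff.smul (f := fun p : M × ℝ => χ p.2) (hχ.contMDiff.comp contMDiff_snd) (hδ c)

lemma smoothFamily_line {φ η : Field C M} (hφ : Smooth φ) (hη : Smooth η) :
    SmoothFamily fun (s : ℝ) c g t => φ c g t + (s : ℂ) * η c g t := fun c => by
  have h1 : ContMDiff (𝓘(ℝ, ℝ).prod (M.I.prod 𝓘(ℝ, ℝ))) 𝓘(ℝ, ℝ) ∞
      (fun z : ℝ × (M × ℝ) => z.1) := contMDiff_fst
  have h := (hφ.family c).add (h1.smul (hη.family c))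
  refine h.congr fun z => ?_
  simp [Complex.real_smul]

lemma variation_line (φ η : Field C M) (s : ℝ) :
    variation (fun (s : ℝ) c g t => φ c g t + (s : ℂ) * η c g t) s = η := by
  funext c g t
  have h := ((Complex.ofRealCLM.hasDerivAt (x := s)).mul_const (η c g t)).const_add (φ c g t)
  simpa [variation] using h.deriv

/-- Since `χ` depends on the clock variable alone, the Leibniz term with `χ'` appears only in the
velocity entry. -/
lemma jet_cut {δ : Field C M} (hδ : Smooth δ) {χ : ℝ → ℝ} (hχ : ContDiff ℝ ∞ χ) (g : M) (t : ℝ) :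
    (jet (cut χ δ) g t).2 = χ t • (jet δ g t).2 + deriv χ t • (0, 0, val δ g t) := by
  refine Prod.ext (funext fun c => ?_) (Prod.ext (funext fun c => ?_) (funext fun c => ?_))
  · change χ t • δ c g t = χ t • δ c g t + deriv χ t • (0 : ℂ)
    simp
  · change leftGrad (fun g => cut χ δ c g t) g =
      χ t • leftGrad (fun g => δ c g t) g + deriv χ t • (0 : M.vec →L[ℝ] ℂ)
    rw [leftGrad_eq ((hδ.cut hχ).contMDiff_slice c t), leftGrad_eq (hδ.contMDiff_slice c t)]
    refine Eq.trans ?_ ((congrArg _ (smul_zero (deriv χ t))).trans (add_zero _)).symm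
    exact congrFun (fderiv_const_smul_field (χ t)
      (f := fun y => δ c (g * (extChartAt M.I (1 : M)).symm y) t)) _
  · change deriv (fun r => χ r • δ c g r) t = χ t • clockDeriv δ g t c + deriv χ t • δ c g t
    exact ((hχ.differentiable (by simp) t).hasDerivAt.smul (hδ.hasDerivAt c g t)).deriv

variable [Fintype C]

namespace Model

variable (S : Model C M)

/-- The pairing of the momenta with a field, integrated over a slice. -/
def slicePair (φ δ : Field C M) (t : ℝ) : ℝ := ∫ g, S.velPair φ g t (val δ g t) ∂M.haar

/-- The interactions see no derivatives and take all legs at one `t`, so `χ'` meets only the momenta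
of the local Lagrangian. -/
lemma sliceVar_cut {φ δ : Field C M} (hφ : Smooth φ) (hδ : Smooth δ) {χ : ℝ → ℝ}
    (hχ : ContDiff ℝ ∞ χ) (t : ℝ) :
    S.sliceVar φ (cut χ δ) t = χ t * S.sliceVar φ δ t + deriv χ t * S.slicePair φ δ t := by
  have h1 : ∀ g, S.locVar φ (cut χ δ) g t =
      χ t * S.locVar φ δ g t + deriv χ t * S.velPair φ g t (val δ g t) := fun g => by
    have : ((0, (jet (cut χ δ) g t).2) : Jet C M) =
        χ t • (0, (jet δ g t).2) + deriv χ t • (0, 0, 0, val δ g t) := by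
      rw [jet_cut hδ hχ]
      refine Prod.ext ?_ rfl
      change (0 : ℝ) = χ t • (0 : ℝ) + deriv χ t • (0 : ℝ)
      simp
    rw [locVar, locVar, velPair, this, map_add, map_smul, map_smul, smul_eq_mul, smul_eq_mul]
  have h2 : ∀ i x, (S.inter i).var φ (cut χ δ) x t = χ t * (S.inter i).var φ δ x t := fun i x => by
    have : ((0, (S.inter i).legVals (cut χ δ) x t) : ℝ × (Fin (S.inter i).arity → Fib C)) =
        χ t • (0, (S.inter i).legVals δ x t) :=
      Prod.ext (mul_zero (χ t)).symm rfl
    rw [Interaction.var, this, map_smul, smul_eq_mul, Interaction.var]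
  have hc : Continuous fun g : M => (g, t) := by fun_prop
  have hj := hφ.contMDiff_jet.continuous.comp hc
  have hj' := hδ.contMDiff_jet.continuous.comp hc
  have hD : Continuous fun g : M => fderiv ℝ (S.locLagrangian g) (jet φ g t) :=
    S.contMDiff_fderiv_locLagrangian.continuous.comp (continuous_id.prodMk hj)
  have i1 : Integrable (fun g => χ t * S.locVar φ δ g t) M.haar :=
    (Continuous.integrable_of_compactSpace
      (hD.clm_apply (continuous_const.prodMk (continuous_snd.comp hj')))).const_mul _
  have i2 : Integrable (fun g => deriv χ t * S.velPair φ g t (val δ g t)) M.haar :=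
    (Continuous.integrable_of_compactSpace (S.continuous_velPair hφ t
      (hδ.contMDiff_val.continuous.comp hc))).const_mul _
  simp only [sliceVar, h1, h2, integral_const_mul, ← Finset.mul_sum]
  rw [integral_add i1 i2, integral_const_mul, integral_const_mul, slicePair]
  ring

/-- The slice pairing is differentiable, with a continuous derivative. -/
lemma exists_hasDerivAt_slicePair {φ δ : Field C M} (hφ : Smooth φ) (hδ : Smooth δ) :
    ∃ P' : ℝ → ℝ, Continuous P' ∧ ∀ t, HasDerivAt (S.slicePair φ δ) (P' t) t := by
  -- The clock variable takes the place of the differentiated parameter; the other real variable is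
  -- a dummy.
  have h := M.integral_param (f := fun r g _ => S.velPair φ g r (val δ g r))
    ((S.contMDiff_velPair hφ hδ).comp (contMDiff_snd.fst.prodMk contMDiff_fst))
  exact ⟨_, h.2.1.comp (by fun_prop : Continuous fun t : ℝ => (t, (0 : ℝ))), fun t => h.2.2 t 0⟩

/-- On shell, the first variation of the slice action is the derivative of the slice pairing. -/
lemma OnShell.hasDerivAt_slicePair {S : Model C M} {φ : Field C M} (hφ : S.OnShell φ)
    {δ : Field C M} (hδ : S.Admissible δ) (t : ℝ) :
    HasDerivAt (S.slicePair φ δ) (S.sliceVar φ δ t) t := by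
  have hφs : Smooth φ := hφ.1.1
  obtain ⟨P', hP'c, hP'⟩ := S.exists_hasDerivAt_slicePair hφs hδ.1
  have hPc : Continuous (S.slicePair φ δ) :=
    continuous_iff_continuousAt.2 fun t => (hP' t).continuousAt
  have hE : Continuous (S.sliceVar φ δ) := by
    have h := (S.continuous_sliceVar (smoothFamily_line hφs hδ.1)).comp
      (by fun_prop : Continuous fun t : ℝ => ((0 : ℝ), t))
    simp only [variation_line] at h
    simpa [Function.comp_def] using h
  have key : ∀ χ : ℝ → ℝ, ContDiff ℝ ∞ χ → HasCompactSupport χ →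
      ∫ t, χ t • (S.sliceVar φ δ t - P' t) = 0 := by
    intro χ hχ hs
    obtain ⟨R, hR0, hR⟩ := hs.isCompact.isBounded.subset_ball_lt 0 0
    rw [Real.ball_eq_Ioo, zero_sub, zero_add] at hR
    have hχ0 : ∀ t ∉ Ioo (-R) R, χ t = 0 := fun t ht =>
      image_eq_zero_of_notMem_tsupport fun h => ht (hR h)
    have hRR : -R < R := by linarith
    have hη : S.Admissible (cut χ δ) := ⟨hδ.1.cut hχ, fun k hk c g t => by
      simp only [cut, hδ.2 k hk]⟩
    have d1 := hφ.2 (-R) R hRR (cut χ δ) hη fun c g t ht => by simp [cut, hχ0 t ht]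
    have hF := smoothFamily_line hφs hη.1
    have d2 := S.hasDerivAt_integral_sliceAction hF (-R) R 0
    simp only [variation_line] at d2
    have e0 : (fun c g t => φ c g t + ((0 : ℝ) : ℂ) * cut χ δ c g t) = φ := by
      funext c g t; simp
    rw [e0] at d2
    have e1 := d1.unique (d2.congr_of_eventuallyEq
      (.of_forall fun s => S.action_eq (hF.smooth s) hRR.le))
    simp only [S.sliceVar_cut hφs hδ.1 hχ] at e1
    have hχ' : Continuous (deriv χ) := hχ.continuous_deriv (by simp)
    have hχd : ∀ t, HasDerivAt χ (deriv χ t) t := fun t =>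
      (hχ.differentiable (by simp) t).hasDerivAt
    -- Integration by parts in `t`: `χ` vanishes at `±R`, so `∫ (χ' P + χ P') = 0`.
    have e2 := intervalIntegral.integral_eq_sub_of_hasDerivAt (a := -R) (b := R)
      (fun t _ => (hχd t).mul (hP' t)) (((hχ'.mul hPc).add (hχ.continuous.mul hP'c)).intervalIntegrable
        _ _)
    simp only [Pi.mul_apply, hχ0 R (by simp), hχ0 (-R) (by simp), zero_mul, sub_zero] at e2
    have hsupp : Function.support (fun t => χ t • (S.sliceVar φ δ t - P' t)) ⊆ Ioc (-R) R := by
      intro t ht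
      by_contra h
      exact ht (by simp [hχ0 t fun h' => h (Ioo_subset_Ioc_self h')])
    rw [← intervalIntegral.integral_eq_integral_of_support_subset hsupp]
    have e3 := intervalIntegral.integral_sub (μ := volume) (a := -R) (b := R)
      (((hχ.continuous.mul hE).add (hχ'.mul hPc)).intervalIntegrable _ _)
      (((hχ'.mul hPc).add (hχ.continuous.mul hP'c)).intervalIntegrable _ _)
    simp only [Pi.add_apply, Pi.mul_apply] at e3
    rw [← e1, e2, sub_zero] at e3
    rw [← e3]
    refine intervalIntegral.integral_congr fun t _ => ?_
    simp only [smul_eq_mul]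
    ring
  -- The fundamental lemma of the calculus of variations gives `E = P'` almost everywhere, and
  -- continuity everywhere.
  have hae := ae_eq_zero_of_integral_contDiff_smul_eq_zero (μ := volume)
    (hE.sub hP'c).locallyIntegrable key
  have hzero : (fun t => S.sliceVar φ δ t - P' t) = fun _ => 0 :=
    Continuous.ae_eq_iff_eq volume (hE.sub hP'c) continuous_const |>.1 hae
  rw [sub_eq_zero.1 (congrFun hzero t)]
  exact hP' t

/-- Conservation of the charge of a symmetry on shell. -/
lemma IsSymmetry.hasDerivAt_charge {S : Model C M} {Φ : PointFlow C M} (hS : S.IsSymmetry Φ)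
    {φ : Field C M} (hφ : S.OnShell φ) (t : ℝ) : HasDerivAt (S.charge Φ φ) 0 t := by
  set R := |t| + 1 with hR
  have hR0 : 0 < R := by positivity
  obtain ⟨Ψ, hΨ, hΨ0, hev⟩ := hS.exists_transforms hφ.1 hR0
  set δ := variation Ψ 0 with hδ
  -- The constraints pass to the derivative in `s`. Thus `δ` is admissible at all clock values,
  -- although it is known to be the characteristic only on `(-R, R)`.
  have hadm : S.Admissible δ := by
    refine ⟨hΨ.variation.smooth 0, fun k hk c g t => Filter.EventuallyEq.deriv_eq ?_⟩
    exact hev.mono fun s hs => hs.1.2 k hk c g t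
  have hchar : ∀ c g, ∀ t ∈ Ioo (-R) R, δ c g t = Φ.char φ c g t := fun c g t ht =>
    Φ.variation_eq_char hΨ hΨ0 (hev.mono fun s hs => hs.2.1) c g ht
  have hcharge : ∀ t ∈ Ioo (-R) R, S.charge Φ φ t =
      ((S.sliceAction φ t * Φ.clockGen t + S.slicePair φ δ t : ℝ) : ℂ) := fun t ht => by
    rw [charge_eq, slicePair]
    simp only [← hchar _ _ t ht]
    rfl
  have hE : Continuous (S.sliceVar φ δ) := by
    have h := (S.continuous_sliceVar hΨ).comp
      (by fun_prop : Continuous fun t : ℝ => ((0 : ℝ), t))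
    simpa only [Function.comp_def, hΨ0] using h
  have hconst : ∀ a ∈ Ioo (-R) R, ∀ b ∈ Ioo (-R) R, a < b → S.charge Φ φ a = S.charge Φ φ b := by
    intro a ha b hb hab
    have hl := S.continuous_sliceAction hΨ
    have hls : ∀ s, Continuous fun t => S.sliceAction (Ψ s) t := fun s =>
      hl.comp (by fun_prop : Continuous fun t : ℝ => (s, t))
    have d1 := S.hasDerivAt_integral_sliceAction hΨ a b 0
    have d2 := hasDerivAt_integral_moving_end (f := fun s t => S.sliceAction (Ψ s) t) hl
      (Φ.hasDerivAt_clock b) (Φ.clock_zero b)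
    have d3 := hasDerivAt_integral_moving_end (f := fun s t => S.sliceAction (Ψ s) t) hl
      (Φ.hasDerivAt_clock a) (Φ.clock_zero a)
    -- The integral over the transformed interval is split into the fixed interval and two short
    -- moving pieces; the total is constant by symmetry.
    have hc : ∀ᶠ s in 𝓝 (0 : ℝ), (∫ t in a..b, S.sliceAction (Ψ s) t) +
        (∫ t in b..Φ.clock s b, S.sliceAction (Ψ s) t) -
        (∫ t in a..Φ.clock s a, S.sliceAction (Ψ s) t) = S.action φ a b := by
      filter_upwards [hev] with s hs
      have hi := fun x y => (hls s).intervalIntegrable (μ := volume) x y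
      rw [← hS.action_eq isOpen_Ioo hφ.1 hs.1 hs.2.1 hs.2.2
        (show Icc a b ⊆ Ioo (-R) R from fun x hx => ⟨ha.1.trans_le hx.1, hx.2.trans_lt hb.2⟩),
        S.action_eq hs.1.1 (Φ.clock_strictMono s hab).le,
        intervalIntegral.integral_add_adjacent_intervals (hi _ _) (hi _ _)]
      exact intervalIntegral.integral_interval_sub_left (hi _ _) (hi _ _)
    have h0 := ((d1.add d2).sub d3).unique
      ((hasDerivAt_const (0 : ℝ) (S.action φ a b)).congr_of_eventuallyEq hc)
    rw [hΨ0, intervalIntegral.integral_eq_sub_of_hasDerivAt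
      (fun t _ => hφ.hasDerivAt_slicePair hadm t) (hE.intervalIntegrable _ _)] at h0
    rw [hcharge a ha, hcharge b hb]
    congr 1
    linarith
  have ht : t ∈ Ioo (-R) R := abs_lt.1 (by rw [hR]; linarith)
  -- The charge is constant near `t`, which also yields its differentiability.
  refine (hasDerivAt_const t (S.charge Φ φ t)).congr_of_eventuallyEq ?_
  filter_upwards [isOpen_Ioo.mem_nhds ht] with r hr
  rcases lt_trichotomy r t with h | h | h
  · exact hconst r hr t ht h
  · rw [h]
  · exact (hconst t ht r hr h).symm

end Model

end GFT

end

theorem mainTheorem7 {C : Type w} [Fintype C] {M : HaarLieGroup.{u}} (S : GFT.Model C M) :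
    -- every symmetry yields a charge that is conserved on shell
    (∀ Φ : GFT.PointFlow C M, S.IsSymmetry Φ → ∀ φ, S.OnShell φ →
      ∀ t, HasDerivAt (S.charge Φ φ) 0 t) ∧
    -- `U(1)` symmetries
    (∀ (θ : C → ℝ) (φ : GFT.Field C M), GFT.Smooth φ → ∀ t,
      (∀ c g, (GFT.phaseFlow M θ).char φ c g t = Complex.I * θ c * φ c g t) ∧
      S.charge (GFT.phaseFlow M θ) φ t =
        Complex.I * ∑ c, (θ c : ℂ) * ∫ g, (φ c g t * S.mom φ c g t -
          (starRingEnd ℂ) (φ c g t) * S.momBar φ c g t) ∂M.haar) ∧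
    -- transformations of the base manifold `M`
    (∀ Φ : GFT.PointFlow C M, Φ.IsPureBase → ∀ φ : GFT.Field C M, GFT.Smooth φ → ∀ t,
      (∀ c g, Φ.char φ c g t = -Φ.lieDeriv φ (φ c) g t) ∧
      S.charge Φ φ t =
        -(∫ g, ∑ c, S.mom φ c g t * Φ.lieDeriv φ (φ c) g t ∂M.haar) -
          ∫ g, ∑ c, S.momBar φ c g t *
            Φ.lieDeriv φ (fun h r => (starRingEnd ℂ) (φ c h r)) g t ∂M.haar) ∧
    -- in particular `SU(2)` symmetries, for `M = SU(2)^n`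
    (∀ (n : ℕ) (e : M ≃* (Fin n → Matrix.specialUnitaryGroup (Fin 2) ℂ))
      (A B : Fin n → Matrix (Fin 2) (Fin 2) ℂ) (Φ : GFT.PointFlow C M),
      Φ.IsSU2Translation e A B → ∀ φ : GFT.Field C M, GFT.Smooth φ → ∀ t,
      (∀ c g, Φ.char φ c g t = -Φ.lieDeriv φ (φ c) g t) ∧
      S.charge Φ φ t =
        -(∫ g, ∑ c, S.mom φ c g t * Φ.lieDeriv φ (φ c) g t ∂M.haar) -
          ∫ g, ∑ c, S.momBar φ c g t *
            Φ.lieDeriv φ (fun h r => (starRingEnd ℂ) (φ c h r)) g t ∂M.haar) ∧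
    -- translations of the clock variable: when they are symmetries, the form of the charge
    (S.ClockIndependent → S.IsSymmetry (GFT.translationFlow C M)) ∧
    (∀ φ : GFT.Field C M, GFT.Smooth φ → ∀ t,
      S.charge (GFT.translationFlow C M) φ t =
        -(∫ g, ∑ c, (S.mom φ c g t * deriv (fun r => φ c g r) t +
          S.momBar φ c g t * deriv (fun r => (starRingEnd ℂ) (φ c g r)) t) ∂M.haar) +
        (S.sliceAction φ t : ℂ)) ∧
    -- the charge is the Legendre transform of the slice Lagrangian up to sign: `Π` is the fibre
    -- derivative of the slice Lagrangian with respect to the velocity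
    (∀ φ : GFT.Field C M, GFT.Smooth φ → ∀ t, ∀ v : C → M → ℂ, (∀ c, Continuous (v c)) →
      HasDerivAt
        (fun s : ℝ => ((S.sliceLagrangian t (GFT.slice φ t)
          (fun c g => GFT.sliceVel φ t c g + (s : ℂ) * v c g) : ℝ) : ℂ))
        (∫ g, ∑ c, (S.mom φ c g t * v c g +
          S.momBar φ c g t * (starRingEnd ℂ) (v c g)) ∂M.haar) 0) := by
  exact ⟨fun _ hΦ _ hφ t => hΦ.hasDerivAt_charge hφ t,
    fun θ φ hφ t => ⟨fun c g => GFT.phaseFlow_char θ φ c g t, S.charge_phaseFlow θ hφ t⟩,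
    fun _ hΦ φ hφ t => ⟨fun c g => hΦ.char_eq φ c g t, S.charge_of_isPureBase hΦ hφ t⟩,
    fun _ _ _ _ _ hΦ φ hφ t =>
      ⟨fun c g => hΦ.2.1.char_eq φ c g t, S.charge_of_isPureBase hΦ.2.1 hφ t⟩,
    S.isSymmetry_translationFlow, fun φ _ t => S.charge_translationFlow φ t,
    fun _ hφ t _ hv => S.hasDerivAt_sliceLagrangian hφ t hv⟩
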